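/- Let $\mathrm{NAE}_3=\{\pm1\}^3\setminus\{(1,1,1),(-1,-1,-1)\}$ be the set of the six possible votes (rankings of three candidates, encoded by the outcomes of the pairwise comparisons). For $\beta\in\mathbb R$ and $n\ge 1$ let $Q_n$ be the mean-field model on $\mathrm{NAE}_3^n$, $$Q_n(x)=\frac1{Z_n}\exp\Big(\frac{\beta}{2n}\sum_{i=1}^n\sum_{j=1}^n\langle x_i,x_j\rangle\Big),$$ where $Z_n$ is the normalizing constant, and let $S_n=\frac1n\sum_{i=1}^n X_i$ with $X\sim Q_n$. For $s\in\mathbb R^3$ let $$\Phi(s)=\frac\beta2\|s\|_2^2+\max_{P\in\mathcal P(\mathrm{NAE}_3):\,\mathbb E_P X=s}H_P(X),$$ where $\mathcal P(\mathrm{NAE}_3)$ is the set of probability distributions on $\mathrm{NAE}_3$, $H_P(X)=-\sum_x P(x)\log P(x)$ is the Shannon entropy, and the maximum is $-\infty$ if there is no such $P$. **Theorem.** Fix $\beta>3/4$, and let $\mathcal S_\beta$ be the set of global maximizers of $\Phi$ on $\mathbb R^3$. 1. $\mathcal S_\beta$ has exactly $6$ elements, and it is a single orbit under permutations of the three coordinates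 and $s\mapsto -s$. It consists of exactly those $s\in\mathbb R^3$ of which two coordinates are equal and the remaining one has strictly opposite sign, and which, with $\lambda=\beta s$, $u_1=\lambda_1+\lambda_2-\lambda_3$, $u_2=\lambda_1-\lambda_2+\lambda_3$, $u_3=-\lambda_1+\lambda_2+\lambda_3$ and $D=\cosh u_1+\cosh u_2+\cosh u_3$, solve the mean-field equations $$s_1=\tfrac{\sinh u_1+\sinh u_2-\sinh u_3}{D},\qquad s_2=\tfrac{\sinh u_1-\sinh u_2+\sinh u_3}{D},\qquad s_3=\tfrac{-\sinh u_1+\sinh u_2+\sinh u_3}{D}.$$ 2. As $n\to\infty$, $S_n$ converges in distribution to the uniform measure on $\mathcal S_\beta$. 3. For every $\epsilon>0$ there is a constant $c=c_{\beta,\epsilon}>0$ such that for all $n\ge1$ $$Q_n\Big(\min_{s\in\mathcal S_\beta}\|S_n-s\|_2\ge\epsilon\Big)\le 2e^{-cn}.$$ -/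

import Mathlib

open MeasureTheory ProbabilityTheory Filter Topology

noncomputable section

namespace MeanFieldElection

/-- The set `NAE₃` of the six vectors in `{±1}³` whose coordinates are not all equal. -/
def NAE3 : Type := {x : Fin 3 → ℤˣ // x ≠ (fun _ => 1) ∧ x ≠ (fun _ => -1)}

instance : Fintype NAE3 :=
  inferInstanceAs (Fintype {x : Fin 3 → ℤˣ // x ≠ (fun _ => 1) ∧ x ≠ (fun _ => -1)})

instance : DecidableEq NAE3 :=
  inferInstanceAs (DecidableEq {x : Fin 3 → ℤˣ // x ≠ (fun _ => 1) ∧ x ≠ (fun _ => -1)})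

/-- The discrete σ-algebra. -/
instance : MeasurableSpace NAE3 := ⊤

instance : DiscreteMeasurableSpace NAE3 := ⟨fun _ => trivial⟩

/-- A vote, viewed as a vector of the Euclidean space `ℝ³`. -/
def NAE3.vec (x : NAE3) : EuclideanSpace ℝ (Fin 3) :=
  WithLp.toLp 2 (fun i => ((x.1 i : ℤ) : ℝ))

/-- The unnormalised weight `exp ((β / 2n) ∑ᵢ ∑ⱼ ⟨xᵢ, xⱼ⟩)` of a voting profile. -/
def weight (β : ℝ) (n : ℕ) (x : Fin n → NAE3) : ℝ :=
  Real.exp (β / (2 * n) * ∑ i, ∑ j, inner ℝ (x i).vec (x j).vec)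

/-- The normalising constant. -/
def partitionFunction (β : ℝ) (n : ℕ) : ℝ :=
  ∑ x : Fin n → NAE3, weight β n x

theorem weight_pos (β : ℝ) (n : ℕ) (x : Fin n → NAE3) : 0 < weight β n x :=
  Real.exp_pos _

instance : Nonempty NAE3 := ⟨⟨![1, 1, -1], by decide⟩⟩

theorem partitionFunction_pos (β : ℝ) (n : ℕ) : 0 < partitionFunction β n :=
  Finset.sum_pos (fun x _ => weight_pos β n x) Finset.univ_nonempty

/-- The mean-field model `Qₙ` on `n` voters: `Qₙ(x) = weight x / Z`. -/
def meanFieldPMF (β : ℝ) (n : ℕ) : PMF (Fin n → NAE3) :=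
  PMF.ofFintype (fun x => ENNReal.ofReal (weight β n x / partitionFunction β n)) (by
    rw [← ENNReal.ofReal_sum_of_nonneg
      (fun x _ => (div_pos (weight_pos β n x) (partitionFunction_pos β n)).le),
      ← Finset.sum_div]
    exact (congrArg ENNReal.ofReal (div_self (partitionFunction_pos β n).ne')).trans
      ENNReal.ofReal_one)

/-- The mean-field model as a measure on voting profiles. -/
def meanField (β : ℝ) (n : ℕ) : Measure (Fin n → NAE3) := (meanFieldPMF β n).toMeasure

instance (β : ℝ) (n : ℕ) : IsProbabilityMeasure (meanField β n) :=
  inferInstanceAs (IsProbabilityMeasure (meanFieldPMF β n).toMeasure)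

/-- The empirical mean vote `Sₙ = (1/n) ∑ᵢ Xᵢ`. -/
def meanVote (n : ℕ) (x : Fin n → NAE3) : EuclideanSpace ℝ (Fin 3) :=
  (n : ℝ)⁻¹ • ∑ i, (x i).vec

/-- The Shannon entropy `-∑ p(x) log p(x)` of a probability vector on `NAE₃`. -/
def entropy (p : NAE3 → ℝ) : ℝ := ∑ x, Real.negMulLog (p x)

/-- The mean `E_p X` of a probability vector on `NAE₃`. -/
def mean (p : NAE3 → ℝ) : EuclideanSpace ℝ (Fin 3) := ∑ x, p x • x.vec

/-- The mean-field functional: `(β/2)‖s‖²` plus the maximal entropy of a probability distribution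
on `NAE₃` with mean `s`; its value is `-∞ = ⊥` if there is no such distribution. -/
def Phi (β : ℝ) (s : EuclideanSpace ℝ (Fin 3)) : EReal :=
  ((β / 2 * ‖s‖ ^ 2 : ℝ) : EReal) +
    ⨆ p ∈ {p : NAE3 → ℝ | p ∈ stdSimplex ℝ NAE3 ∧ mean p = s}, (entropy p : EReal)

/-- The set of global maximizers of `Φ`. -/
def globalMaximizers (β : ℝ) : Set (EuclideanSpace ℝ (Fin 3)) :=
  {s | ∀ t, Phi β t ≤ Phi β s}

/-- The mean-field equations for `s`, with dual variables `l = β s`. -/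
def MeanFieldEquations (β : ℝ) (s : EuclideanSpace ℝ (Fin 3)) : Prop :=
  ∃ l : Fin 3 → ℝ, (∀ i, l i = β * s i) ∧
    s 0 = (Real.sinh (l 0 + l 1 - l 2) + Real.sinh (l 0 - l 1 + l 2)
            - Real.sinh (-l 0 + l 1 + l 2)) /
          (Real.cosh (l 0 + l 1 - l 2) + Real.cosh (l 0 - l 1 + l 2)
            + Real.cosh (-l 0 + l 1 + l 2)) ∧
    s 1 = (Real.sinh (l 0 + l 1 - l 2) - Real.sinh (l 0 - l 1 + l 2)
            + Real.sinh (-l 0 + l 1 + l 2)) /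
          (Real.cosh (l 0 + l 1 - l 2) + Real.cosh (l 0 - l 1 + l 2)
            + Real.cosh (-l 0 + l 1 + l 2)) ∧
    s 2 = (-Real.sinh (l 0 + l 1 - l 2) + Real.sinh (l 0 - l 1 + l 2)
            + Real.sinh (-l 0 + l 1 + l 2)) /
          (Real.cosh (l 0 + l 1 - l 2) + Real.cosh (l 0 - l 1 + l 2)
            + Real.cosh (-l 0 + l 1 + l 2))

/-- Two coordinates are equal, and the remaining one has strictly opposite sign. -/
def TwoEqualOneOpposite (s : EuclideanSpace ℝ (Fin 3)) : Prop :=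
  ∃ σ : Equiv.Perm (Fin 3), s (σ 0) = s (σ 1) ∧ s (σ 0) * s (σ 2) < 0

/-- `t` is obtained from `s` by permuting the coordinates and possibly changing the sign of the
whole vector. -/
def SameOrbit (s t : EuclideanSpace ℝ (Fin 3)) : Prop :=
  ∃ (σ : Equiv.Perm (Fin 3)) (e : ℤˣ), ∀ i, t i = ((e : ℤ) : ℝ) * s (σ i)

end MeanFieldElection

end

namespace MeanFieldElection

open Real Set

/-! Gibbs' inequality with external field `β • s` bounds `Phi` by the explicit smooth function
`Psi`, and a mean-field step gains `β/2` times its squared length, so both functions have the same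
maximizers, all of them fixed points (`mem_globalMaximizers_iff`). In the coordinates `u = field (β
• s)` one maximizes `log ∑ cosh uᵢ - κ/2 (∑ uᵢ² + (∑ uᵢ)²)` with `κ = 1/(4β) < 1/3`.

At a critical point the points `(uᵢ, sinh uᵢ)` lie on one line. If the `uᵢ` were distinct, the
second variation along `u × (1,1,1)` would be positive, since the fifth divided difference of `sinh`
on doubled nodes is positive (`collinear_sinh_pos`); hence two of them agree. The condition `κ <
1/3` excludes the origin and a reflection fixes the signs. Critical points `(x, -y, -y)` with `x, y
> 0` are unique: two monotonicity statements along rays exclude different ratios `y / x`, and the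
ratio determines `x` (`SymmCritical.unique`). So the maximizers form one orbit of six points.

For the probabilistic claims, replacing the quadratic energy by its tangent at `t` makes the votes
independent. This gives `exp (n Psi t) ≤ Z` and matching upper bounds on small balls, and
compactness yields the exponential estimate. The weak limit follows by symmetrizing test functions,
which makes them constant on the maximizers. -/

/-! ### Collinear points on the graph of `sinh` -/

/-- Repeated Rolle for a function with three double zeros. -/
theorem exists_fifth_deriv_eq_zero {h : ℕ → ℝ → ℝ}
    (hd : ∀ i x, HasDerivAt (h i) (h (i + 1) x) x) {a b c : ℝ} (hab : a < b) (hbc : b < c)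
    (ha : h 0 a = 0) (hb : h 0 b = 0) (hc : h 0 c = 0)
    (ha' : h 1 a = 0) (hb' : h 1 b = 0) (hc' : h 1 c = 0) : ∃ ξ, h 5 ξ = 0 := by
  have rolle : ∀ i {u v : ℝ}, u < v → h i u = 0 → h i v = 0 →
      ∃ w, u < w ∧ w < v ∧ h (i + 1) w = 0 := by
    intro i u v huv hu hv
    obtain ⟨w, hw, hw0⟩ := exists_hasDerivAt_eq_zero huv
      (fun x _ => (hd i x).continuousAt.continuousWithinAt) (hu.trans hv.symm)
      (fun x _ => hd i x)
    exact ⟨w, hw.1, hw.2, hw0⟩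
  -- With `p` and `q`, `h 1` has the five zeros `a < p < b < q < c`; each further application of
  -- Rolle loses one.
  obtain ⟨p, hap, hpb, hp⟩ := rolle 0 hab ha hb
  obtain ⟨q, hbq, hqc, hq⟩ := rolle 0 hbc hb hc
  obtain ⟨r₁, h1, h1', hr₁⟩ := rolle 1 hap ha' hp
  obtain ⟨r₂, h2, h2', hr₂⟩ := rolle 1 hpb hp hb'
  obtain ⟨r₃, h3, h3', hr₃⟩ := rolle 1 hbq hb' hq
  obtain ⟨r₄, h4, h4', hr₄⟩ := rolle 1 hqc hq hc'
  obtain ⟨s₁, k1, k1', hs₁⟩ := rolle 2 (h1'.trans h2) hr₁ hr₂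
  obtain ⟨s₂, k2, k2', hs₂⟩ := rolle 2 (h2'.trans h3) hr₂ hr₃
  obtain ⟨s₃, k3, k3', hs₃⟩ := rolle 2 (h3'.trans h4) hr₃ hr₄
  obtain ⟨t₁, l1, l1', ht₁⟩ := rolle 3 (k1'.trans k2) hs₁ hs₂
  obtain ⟨t₂, l2, l2', ht₂⟩ := rolle 3 (k2'.trans k3) hs₂ hs₃
  obtain ⟨ξ, -, -, hξ⟩ := rolle 4 (l1'.trans l2) ht₁ ht₂
  exact ⟨ξ, hξ⟩

/-- A quintic that agrees with `sinh` to first order at three points has positive leading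
coefficient. -/
theorem leadingCoeff_pos_of_hermite_sinh {c₀ c₁ c₂ c₃ c₄ c₅ x₁ x₂ x₃ : ℝ} (h12 : x₁ < x₂)
    (h23 : x₂ < x₃)
    (h0 : ∀ x, x = x₁ ∨ x = x₂ ∨ x = x₃ →
      sinh x = c₀ + c₁ * x + c₂ * x ^ 2 + c₃ * x ^ 3 + c₄ * x ^ 4 + c₅ * x ^ 5)
    (h1 : ∀ x, x = x₁ ∨ x = x₂ ∨ x = x₃ →
      cosh x = c₁ + 2 * c₂ * x + 3 * c₃ * x ^ 2 + 4 * c₄ * x ^ 3 + 5 * c₅ * x ^ 4) : 0 < c₅ := by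
  let h : ℕ → ℝ → ℝ := fun n => match n with
    | 0 => fun x => sinh x - (c₀ + c₁ * x + c₂ * x ^ 2 + c₃ * x ^ 3 + c₄ * x ^ 4 + c₅ * x ^ 5)
    | 1 => fun x => cosh x - (c₁ + 2 * c₂ * x + 3 * c₃ * x ^ 2 + 4 * c₄ * x ^ 3 + 5 * c₅ * x ^ 4)
    | 2 => fun x => sinh x - (2 * c₂ + 6 * c₃ * x + 12 * c₄ * x ^ 2 + 20 * c₅ * x ^ 3)
    | 3 => fun x => cosh x - (6 * c₃ + 24 * c₄ * x + 60 * c₅ * x ^ 2)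
    | 4 => fun x => sinh x - (24 * c₄ + 120 * c₅ * x)
    | 5 => fun x => cosh x - 120 * c₅
    -- Orders above five are never used; they only make the derivative chain hold at every index.
    | (n + 6) => fun x => if Even n then sinh x else cosh x
  have hX : ∀ (n : ℕ) (x : ℝ), HasDerivAt (fun x : ℝ => x ^ n) (n * x ^ (n - 1)) x :=
    fun n x => hasDerivAt_pow n x
  have hd : ∀ i x, HasDerivAt (h i) (h (i + 1) x) x := by
    intro i x
    match i with
    | 0 =>
      refine ((hasDerivAt_sinh x).sub ((((((hasDerivAt_const x c₀).add
        ((hasDerivAt_id x).const_mul c₁)).add ((hX 2 x).const_mul c₂)).add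
        ((hX 3 x).const_mul c₃)).add ((hX 4 x).const_mul c₄)).add
        ((hX 5 x).const_mul c₅))).congr_deriv ?_
      simp only [h]; norm_num; ring
    | 1 =>
      refine ((hasDerivAt_cosh x).sub (((((hasDerivAt_const x c₁).add
        ((hasDerivAt_id x).const_mul (2 * c₂))).add ((hX 2 x).const_mul (3 * c₃))).add
        ((hX 3 x).const_mul (4 * c₄))).add ((hX 4 x).const_mul (5 * c₅)))).congr_deriv ?_
      simp only [h]; norm_num; ring
    | 2 =>
      refine ((hasDerivAt_sinh x).sub ((((hasDerivAt_const x (2 * c₂)).add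
        ((hasDerivAt_id x).const_mul (6 * c₃))).add ((hX 2 x).const_mul (12 * c₄))).add
        ((hX 3 x).const_mul (20 * c₅)))).congr_deriv ?_
      simp only [h]; norm_num; ring
    | 3 =>
      refine ((hasDerivAt_cosh x).sub (((hasDerivAt_const x (6 * c₃)).add
        ((hasDerivAt_id x).const_mul (24 * c₄))).add
        ((hX 2 x).const_mul (60 * c₅)))).congr_deriv ?_
      simp only [h]; norm_num; ring
    | 4 =>
      refine ((hasDerivAt_sinh x).sub ((hasDerivAt_const x (24 * c₄)).add
        ((hasDerivAt_id x).const_mul (120 * c₅)))).congr_deriv ?_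
      simp only [h]; norm_num
    | 5 =>
      refine ((hasDerivAt_cosh x).sub (hasDerivAt_const x (120 * c₅))).congr_deriv ?_
      simp [h]
    | (n + 6) =>
      by_cases hn : Even n
      · have : ¬ Even (n + 1) := by simpa [Nat.even_add_one] using hn
        simpa [h, hn, this] using hasDerivAt_sinh x
      · have : Even (n + 1) := by simpa [Nat.even_add_one] using hn
        simpa [h, hn, this] using hasDerivAt_cosh x
  have e0 : ∀ x, x = x₁ ∨ x = x₂ ∨ x = x₃ → h 0 x = 0 := fun x hx => sub_eq_zero.2 (h0 x hx)
  have e1 : ∀ x, x = x₁ ∨ x = x₂ ∨ x = x₃ → h 1 x = 0 := fun x hx => sub_eq_zero.2 (h1 x hx)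
  obtain ⟨ξ, hξ⟩ := exists_fifth_deriv_eq_zero hd h12 h23 (e0 _ (by simp)) (e0 _ (by simp))
    (e0 _ (by simp)) (e1 _ (by simp)) (e1 _ (by simp)) (e1 _ (by simp))
  have h2 : cosh ξ - 120 * c₅ = 0 := hξ
  have := cosh_pos ξ
  linarith

/-- Once the chord is subtracted, the quintic Hermite interpolant of `sinh` vanishes at all three
nodes. Its leading coefficient is then the expression below divided by the squared Vandermonde
product. -/
theorem collinear_sinh_pos {x₁ x₂ x₃ m k : ℝ} (h12 : x₁ < x₂) (h23 : x₂ < x₃)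
    (e₁ : sinh x₁ = m * x₁ + k) (e₂ : sinh x₂ = m * x₂ + k) (e₃ : sinh x₃ = m * x₃ + k) :
    0 < (x₂ - x₃) ^ 2 * (cosh x₁ - m) + (x₃ - x₁) ^ 2 * (cosh x₂ - m)
      + (x₁ - x₂) ^ 2 * (cosh x₃ - m) := by
  have d12 : x₁ - x₂ ≠ 0 := (sub_neg.2 h12).ne
  have d23 : x₂ - x₃ ≠ 0 := (sub_neg.2 h23).ne
  have d31 : x₃ - x₁ ≠ 0 := (sub_pos.2 (h12.trans h23)).ne'
  -- The quadratic cofactor has the Lagrange form `w₁(x-x₂)(x-x₃) + w₂(x-x₁)(x-x₃) +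
  -- w₃(x-x₁)(x-x₂)`. Matching the derivative at each node gives these equations.
  obtain ⟨w₁, hw₁⟩ : ∃ w, w * ((x₁ - x₂) * (x₃ - x₁)) ^ 2 = cosh x₁ - m :=
    ⟨(cosh x₁ - m) / ((x₁ - x₂) * (x₃ - x₁)) ^ 2, by field_simp⟩
  obtain ⟨w₂, hw₂⟩ : ∃ w, w * ((x₁ - x₂) * (x₂ - x₃)) ^ 2 = cosh x₂ - m :=
    ⟨(cosh x₂ - m) / ((x₁ - x₂) * (x₂ - x₃)) ^ 2, by field_simp⟩
  obtain ⟨w₃, hw₃⟩ : ∃ w, w * ((x₃ - x₁) * (x₂ - x₃)) ^ 2 = cosh x₃ - m :=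
    ⟨(cosh x₃ - m) / ((x₃ - x₁) * (x₂ - x₃)) ^ 2, by field_simp⟩
  -- the Hermite interpolant is `m x + k + (x - x₁)(x - x₂)(x - x₃)(a + b x + c x²)`
  obtain ⟨a, ha⟩ : ∃ a, a = w₁ * (x₂ * x₃) + w₂ * (x₁ * x₃) + w₃ * (x₁ * x₂) := ⟨_, rfl⟩
  obtain ⟨b, hb⟩ : ∃ b, b = -(w₁ * (x₂ + x₃) + w₂ * (x₁ + x₃) + w₃ * (x₁ + x₂)) := ⟨_, rfl⟩
  obtain ⟨c, hc⟩ : ∃ c, c = w₁ + w₂ + w₃ := ⟨_, rfl⟩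
  obtain ⟨p, hp⟩ : ∃ p, p = x₁ + x₂ + x₃ := ⟨_, rfl⟩
  obtain ⟨q, hq⟩ : ∃ q, q = x₁ * x₂ + x₂ * x₃ + x₃ * x₁ := ⟨_, rfl⟩
  obtain ⟨r, hr⟩ : ∃ r, r = x₁ * x₂ * x₃ := ⟨_, rfl⟩
  have hpos : 0 < c := by
    refine leadingCoeff_pos_of_hermite_sinh (c₀ := k - r * a) (c₁ := m + q * a - r * b)
      (c₂ := -p * a + q * b - r * c) (c₃ := a - p * b + q * c) (c₄ := b - p * c) h12 h23 ?_ ?_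
    · rintro x (rfl | rfl | rfl)
      · rw [e₁, hp, hq, hr]; ring
      · rw [e₂, hp, hq, hr]; ring
      · rw [e₃, hp, hq, hr]; ring
    · rintro x (rfl | rfl | rfl)
      · rw [← sub_add_cancel (cosh x) m, ← hw₁, hp, hq, hr, ha, hb, hc]; ring
      · rw [← sub_add_cancel (cosh x) m, ← hw₂, hp, hq, hr, ha, hb, hc]; ring
      · rw [← sub_add_cancel (cosh x) m, ← hw₃, hp, hq, hr, ha, hb, hc]; ring
  have : (x₂ - x₃) ^ 2 * (cosh x₁ - m) + (x₃ - x₁) ^ 2 * (cosh x₂ - m)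
      + (x₁ - x₂) ^ 2 * (cosh x₃ - m) = c * ((x₁ - x₂) * (x₂ - x₃) * (x₃ - x₁)) ^ 2 := by
    rw [← hw₁, ← hw₂, ← hw₃, hc]; ring
  rw [this]
  positivity

/-- The previous lemma for three distinct points in any order. -/
theorem collinear_sinh_pos_of_ne {x₁ x₂ x₃ m k : ℝ} (h12 : x₁ ≠ x₂) (h23 : x₂ ≠ x₃) (h31 : x₃ ≠ x₁)
    (e₁ : sinh x₁ = m * x₁ + k) (e₂ : sinh x₂ = m * x₂ + k) (e₃ : sinh x₃ = m * x₃ + k) :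
    0 < (x₂ - x₃) ^ 2 * (cosh x₁ - m) + (x₃ - x₁) ^ 2 * (cosh x₂ - m)
      + (x₁ - x₂) ^ 2 * (cosh x₃ - m) := by
  rcases lt_or_gt_of_ne h12 with a | a <;> rcases lt_or_gt_of_ne h23 with b | b <;>
    rcases lt_or_gt_of_ne h31 with c | c
  · exact absurd (a.trans (b.trans c)) (lt_irrefl _)
  · linarith [collinear_sinh_pos a b e₁ e₂ e₃]
  · linarith [collinear_sinh_pos c a e₃ e₁ e₂]
  · linarith [collinear_sinh_pos c b e₁ e₃ e₂]
  · linarith [collinear_sinh_pos b c e₂ e₃ e₁]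
  · linarith [collinear_sinh_pos a c e₂ e₁ e₃]
  · linarith [collinear_sinh_pos b a e₃ e₂ e₁]
  · exact absurd (a.trans (c.trans b)) (lt_irrefl _)

/-! ### Elementary bounds for hyperbolic functions -/

theorem strictMonoOn_Ici_of_hasDerivAt {f f' : ℝ → ℝ} {a : ℝ} (hf : ∀ x, HasDerivAt f (f' x) x)
    (hpos : ∀ x, a < x → 0 < f' x) : StrictMonoOn f (Ici a) := by
  refine strictMonoOn_of_deriv_pos (convex_Ici a)
    (fun x _ => (hf x).continuousAt.continuousWithinAt) fun x hx => ?_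
  rw [interior_Ici] at hx
  rw [(hf x).deriv]
  exact hpos x hx

theorem self_lt_sinh {x : ℝ} (hx : 0 < x) : x < sinh x := self_lt_sinh_iff.2 hx

theorem self_lt_sinh_mul_cosh {x : ℝ} (hx : 0 < x) : x < sinh x * cosh x := by
  nlinarith [self_lt_sinh hx, one_le_cosh x]

theorem sinh_lt_mul_cosh {x : ℝ} (hx : 0 < x) : sinh x < x * cosh x := by
  have := strictMonoOn_Ici_of_hasDerivAt (f := fun x => x * cosh x - sinh x)
    (f' := fun x => x * sinh x) (a := 0)
    (fun x => (((hasDerivAt_id x).mul (hasDerivAt_cosh x)).sub (hasDerivAt_sinh x)).congr_deriv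
      (by simp)) (fun x hx => mul_pos hx (sinh_pos_iff.2 hx)) self_mem_Ici hx.le hx
  simp at this
  linarith

theorem two_mul_cosh_sub_one_le {x : ℝ} (hx : 0 ≤ x) : 2 * (cosh x - 1) ≤ x * sinh x := by
  have := (strictMonoOn_Ici_of_hasDerivAt (f := fun x => x * sinh x - 2 * cosh x)
    (f' := fun x => x * cosh x - sinh x) (a := 0)
    (fun x => (((hasDerivAt_id x).mul (hasDerivAt_sinh x)).sub
      ((hasDerivAt_cosh x).const_mul 2)).congr_deriv (by simp; ring))
    (fun x hx => sub_pos.2 (sinh_lt_mul_cosh hx))).monotoneOn self_mem_Ici hx hx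
  simp at this
  linarith

theorem mul_one_add_two_cosh_lt {x : ℝ} (hx : 0 < x) :
    x * (1 + 2 * cosh x) < sinh x * (cosh x + 2) := by
  have := strictMonoOn_Ici_of_hasDerivAt
    (f := fun x => sinh x * (cosh x + 2) - x * (1 + 2 * cosh x))
    (f' := fun x => 2 * sinh x * (sinh x - x)) (a := 0)
    (fun x => (((hasDerivAt_sinh x).mul ((hasDerivAt_cosh x).add_const 2)).sub
      ((hasDerivAt_id x).mul (((hasDerivAt_cosh x).const_mul 2).const_add 1))).congr_deriv
      (by simp; linear_combination cosh_sq x)) (fun x hx => mul_pos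
        (mul_pos two_pos (sinh_pos_iff.2 hx)) (sub_pos.2 (self_lt_sinh hx))) self_mem_Ici hx.le hx
  simp at this
  linarith

theorem exp_three_halves_ge : (4 : ℝ) ≤ exp (3 / 2) := by
  have h : exp (3 / 2) = exp (1 / 2) ^ 3 := by rw [← exp_nat_mul]; norm_num
  have h1 : (1.6 : ℝ) ≤ exp (1 / 2) := by
    have := quadratic_le_exp_of_nonneg (x := 1 / 2) (by norm_num)
    norm_num at this ⊢
    linarith
  rw [h]
  calc (4 : ℝ) ≤ 1.6 ^ 3 := by norm_num
    _ ≤ _ := by gcongr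

theorem exp_five_halves_ge : (12 : ℝ) ≤ exp (5 / 2) := by
  have h : exp (5 / 2) ^ 2 = exp 1 ^ 5 := by
    rw [← exp_nat_mul, ← exp_nat_mul]; norm_num
  have h1 : (2.71 : ℝ) ^ 5 ≤ exp 1 ^ 5 := by
    gcongr
    linarith [exp_one_gt_d9]
  rw [← h] at h1
  by_contra! hc
  nlinarith [exp_pos (5 / 2)]

/-- Put `A = x coth x - 1`; the task is to bound `A cosh y - y sinh y`. For `A ≤ 2` it is largest at
`y = 0`, where `mul_one_add_two_cosh_lt` applies. For `A > 2`, `x` is large and exponential bounds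
suffice. With `y = r * x` this makes the derivative in `strictMonoOn_mul_cosh_add_div_sinh`
positive. -/
theorem mul_cosh_sub_le {x y : ℝ} (hx : 0 < x) (hy : 0 ≤ y) :
    2 * (x * cosh x * cosh y - sinh x * cosh y - y * sinh x * sinh y) < sinh x * cosh x - x := by
  have hs := sinh_pos_iff.2 hx
  have key := mul_one_add_two_cosh_lt hx
  rcases le_or_gt (x * cosh x) (3 * sinh x) with h | h
  · have h1 := two_mul_cosh_sub_one_le hy
    have h2 := one_le_cosh y
    have h3 : (cosh y - 1) * (x * cosh x - sinh x) ≤ (cosh y - 1) * (2 * sinh x) :=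
      mul_le_mul_of_nonneg_left (by linarith) (by linarith)
    have h4 : sinh x * (2 * (cosh y - 1)) ≤ sinh x * (y * sinh y) :=
      mul_le_mul_of_nonneg_left h1 hs.le
    nlinarith
  · have hc : 4 < cosh x := by
      by_contra! hc
      nlinarith
    have hE : exp x = cosh x + sinh x := (cosh_add_sinh x).symm
    have hE' : exp (-x) = cosh x - sinh x := (cosh_sub_sinh x).symm
    have hEE : exp x * exp (-x) = 1 := by rw [← exp_add]; simp
    have hx1 : 1 ≤ x := by
      by_contra! h1
      have : exp x < exp 1 := exp_lt_exp.2 h1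
      linarith [exp_one_lt_d9]
    obtain ⟨A, hA⟩ : ∃ A, A * sinh x = x * cosh x - sinh x :=
      ⟨(x * cosh x - sinh x) / sinh x, by field_simp⟩
    have hA2 : 2 < A := by
      by_contra! hc
      nlinarith
    -- Equivalent to `x (coth x - 1) ≤ 1/2`, that is, `4x + 1 ≤ exp (2x)`; the quadratic Taylor
    -- bound gives this once `x ≥ 1`.
    have hAx : A ≤ x - 1 / 2 := by
      have h1 : 4 * x + 1 ≤ exp (2 * x) := by
        have := quadratic_le_exp_of_nonneg (x := 2 * x) (by linarith)
        nlinarith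
      have h2 : exp (2 * x) = exp x * exp x := by rw [← exp_add]; ring_nf
      have h3 : (4 * x + 1) * exp (-x) ≤ exp x := by
        calc (4 * x + 1) * exp (-x) ≤ exp x * exp x * exp (-x) := by
              rw [← h2]; exact mul_le_mul_of_nonneg_right h1 (exp_pos _).le
          _ = exp x := by rw [mul_assoc, hEE, mul_one]
      have h4 : A * sinh x ≤ (x - 1 / 2) * sinh x := by
        rw [hE, hE'] at h3
        nlinarith
      exact le_of_mul_le_mul_right h4 hs
    have hx52 : 5 / 2 < x := by linarith
    have h1 : exp (A - 1) ≤ exp x / 4 := by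
      have : exp (A - 1) * exp (3 / 2) ≤ exp x := by
        rw [← exp_add]
        exact exp_le_exp.2 (by linarith)
      nlinarith [exp_three_halves_ge, exp_pos (A - 1)]
    -- The line `12 (x - 3/2)`, which lies below `exp` on this range, meets `4x + 2` exactly at `x =
    -- 5/2`.
    have h2 : 4 * x + 2 ≤ exp x := by
      have e : exp x = exp (5 / 2) * exp (x - 5 / 2) := by rw [← exp_add]; ring_nf
      have := add_one_le_exp (x - 5 / 2)
      have : 12 * (x - 3 / 2) ≤ exp x := by
        rw [e]
        exact mul_le_mul exp_five_halves_ge (by linarith) (by linarith) (exp_pos _).le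
      linarith
    have h3 : (A - y) * exp y ≤ exp (A - 1) := by
      have := add_one_le_exp (A - y - 1)
      calc (A - y) * exp y ≤ exp (A - y - 1) * exp y :=
            mul_le_mul_of_nonneg_right (by linarith) (exp_pos _).le
        _ = exp (A - 1) := by rw [← exp_add]; ring_nf
    have h4 : (A + y) * exp (-y) ≤ A := by
      have hy1 := add_one_le_exp y
      have : (A + y) * exp (-y) ≤ (A * exp y) * exp (-y) :=
        mul_le_mul_of_nonneg_right (by nlinarith) (exp_pos _).le
      rwa [mul_assoc, ← exp_add, add_neg_cancel, exp_zero, mul_one] at this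
    have h5 : 2 * (A * cosh y - y * sinh y) = (A - y) * exp y + (A + y) * exp (-y) := by
      rw [← cosh_add_sinh y, ← cosh_sub_sinh y]; ring
    have h6 : x < sinh x := self_lt_sinh hx
    have h7 : exp x / 2 < cosh x := by linarith [sinh_lt_cosh x]
    have h8 : 2 * (A * cosh y - y * sinh y) < cosh x - 1 := by linarith
    have h9 := mul_lt_mul_of_pos_left h8 hs
    have : 2 * (x * cosh x * cosh y - sinh x * cosh y - y * sinh x * sinh y)
        = sinh x * (2 * (A * cosh y - y * sinh y)) := by
      linear_combination (-2 * cosh y) * hA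
    rw [this]
    nlinarith

/-! ### Uniqueness of the symmetric critical point -/

theorem strictMonoOn_of_hasDerivAt_pos {f f' : ℝ → ℝ} {D : Set ℝ} (hD : Convex ℝ D)
    (hf : ∀ x ∈ D, HasDerivAt f (f' x) x) (hpos : ∀ x ∈ D, 0 < f' x) : StrictMonoOn f D := by
  refine strictMonoOn_of_deriv_pos hD
    (fun x hx => (hf x hx).continuousAt.continuousWithinAt) fun x hx => ?_
  rw [(hf x (interior_subset hx)).deriv]
  exact hpos x (interior_subset hx)

theorem strictMonoOn_mul_coth : StrictMonoOn (fun x => x * cosh x / sinh x) (Ioi 0) := by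
  refine strictMonoOn_of_hasDerivAt_pos (convex_Ioi 0)
    (f' := fun x => (sinh x * cosh x - x) / sinh x ^ 2) (fun x hx => ?_) (fun x hx => ?_)
  · refine (((hasDerivAt_id x).mul (hasDerivAt_cosh x)).div (hasDerivAt_sinh x)
      (sinh_pos_iff.2 hx).ne').congr_deriv ?_
    congr 1
    simp
    linear_combination (-x) * cosh_sq x
  · exact div_pos (sub_pos.2 (self_lt_sinh_mul_cosh hx)) (pow_pos (sinh_pos_iff.2 hx) 2)

/-- The sign of the derivative is a comparison of `x coth x` at `r * x` and at `x`. -/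
theorem strictMonoOn_sinh_div_sinh {r : ℝ} (h0 : 0 < r) (h1 : r < 1) :
    StrictMonoOn (fun x => -(sinh (r * x) / sinh x)) (Ioi 0) := by
  refine strictMonoOn_of_hasDerivAt_pos (convex_Ioi 0)
    (f' := fun x => (sinh (r * x) * cosh x - r * cosh (r * x) * sinh x) / sinh x ^ 2)
    (fun x hx => ?_) (fun x hx => ?_)
  · have hr : HasDerivAt (fun x => sinh (r * x)) (cosh (r * x) * r) x :=
      (hasDerivAt_sinh (r * x)).comp x (by simpa using (hasDerivAt_id x).const_mul r)
    refine (hr.div (hasDerivAt_sinh x) (sinh_pos_iff.2 hx).ne').neg.congr_deriv ?_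
    rw [← neg_div]
    congr 1
    ring
  · have hx : 0 < x := hx
    have hrx : 0 < r * x := mul_pos h0 hx
    have hs := sinh_pos_iff.2 hx
    have hs' := sinh_pos_iff.2 hrx
    have h := strictMonoOn_mul_coth (mem_Ioi.2 hrx) hx (by nlinarith)
    simp only at h
    rw [div_lt_div_iff₀ hs' hs] at h
    refine div_pos ?_ (pow_pos hs 2)
    have : 0 < x * (sinh (r * x) * cosh x - r * cosh (r * x) * sinh x) := by linarith
    exact (pos_iff_pos_of_mul_pos this).1 hx

theorem strictMonoOn_mul_cosh_add_div_sinh {r : ℝ} (h0 : 0 < r) :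
    StrictMonoOn (fun x => x * (cosh x + 2 * cosh (r * x)) / sinh x) (Ioi 0) := by
  refine strictMonoOn_of_hasDerivAt_pos (convex_Ioi 0)
    (f' := fun x => ((sinh x * cosh x - x) - 2 * (x * cosh x * cosh (r * x)
      - sinh x * cosh (r * x) - (r * x) * sinh x * sinh (r * x))) / sinh x ^ 2)
    (fun x hx => ?_) (fun x hx => ?_)
  · have hr : HasDerivAt (fun x => cosh (r * x)) (sinh (r * x) * r) x :=
      (hasDerivAt_cosh (r * x)).comp x (by simpa using (hasDerivAt_id x).const_mul r)
    refine (((hasDerivAt_id x).mul ((hasDerivAt_cosh x).add (hr.const_mul 2))).div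
      (hasDerivAt_sinh x) (sinh_pos_iff.2 hx).ne').congr_deriv ?_
    congr 1
    simp
    linear_combination (-x) * cosh_sq x
  · have hx : 0 < x := hx
    refine div_pos ?_ (pow_pos (sinh_pos_iff.2 hx) 2)
    linarith [mul_cosh_sub_le hx (mul_pos h0 hx).le]

theorem sub_mul_cosh_le {x y : ℝ} (hy : 0 < y) (hxy : y < x) : (x - y) * cosh y ≤ sinh x := by
  have h1 : x - y ≤ sinh (x - y) := (self_lt_sinh (sub_pos.2 hxy)).le
  have h2 : sinh x = sinh (x - y) * cosh y + cosh (x - y) * sinh y := by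
    rw [← sinh_add, sub_add_cancel]
  have h3 := mul_le_mul_of_nonneg_right h1 (cosh_pos y).le
  nlinarith [mul_pos (cosh_pos (x - y)) (sinh_pos_iff.2 hy)]

theorem two_mul_sub_mul_sinh_lt {x y : ℝ} (hxy : y < x) :
    2 * (x - y) * sinh y < cosh x + 2 * cosh y := by
  have h1 : x - y ≤ exp (x - y - 1) := by linarith [add_one_le_exp (x - y - 1)]
  have h2 : (x - y) * exp y ≤ exp (x - 1) :=
    calc (x - y) * exp y ≤ exp (x - y - 1) * exp y :=
          mul_le_mul_of_nonneg_right h1 (exp_pos _).le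
      _ = exp (x - 1) := by rw [← exp_add]; ring_nf
  have h3 : 2 * sinh y ≤ exp y := by
    rw [← cosh_add_sinh y]; linarith [sinh_lt_cosh y]
  have h4 : (x - y) * (2 * sinh y) ≤ (x - y) * exp y :=
    mul_le_mul_of_nonneg_left h3 (sub_pos.2 hxy).le
  have h5 : exp (x - 1) * 2 ≤ exp x := by
    have e : exp x = exp (x - 1) * exp 1 := by rw [← exp_add]; ring_nf
    rw [e]
    exact mul_le_mul_of_nonneg_left (by linarith [exp_one_gt_d9]) (exp_pos _).le
  have h6 : exp x = cosh x + sinh x := (cosh_add_sinh x).symm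
  linarith [sinh_lt_cosh x, cosh_pos y]

/-- Eliminating the common factor `κ (cosh x + 2 cosh y)` from the two equations of `SymmCritical`
says that this function of `y` vanishes. -/
theorem strictMonoOn_compat {x : ℝ} :
    StrictMonoOn (fun y => sinh x * (3 * y - x) - 2 * sinh y * (x - y)) (Ioo 0 x) := by
  refine strictMonoOn_of_hasDerivAt_pos (convex_Ioo 0 x)
    (f' := fun y => 3 * sinh x - 2 * (cosh y * (x - y)) + 2 * sinh y) (fun y hy => ?_)
    (fun y hy => ?_)
  · refine (((((hasDerivAt_id y).const_mul 3).sub_const x).const_mul (sinh x)).sub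
      (((hasDerivAt_sinh y).const_mul 2).mul ((hasDerivAt_id y).const_sub x))).congr_deriv ?_
    simp
    ring
  · have h1 := sub_mul_cosh_le hy.1 hy.2
    have h2 := sinh_pos_iff.2 hy.1
    have h3 := sinh_pos_iff.2 (hy.1.trans hy.2)
    linarith

theorem strictMonoOn_neg_sub_mul_cosh_add {x : ℝ} :
    StrictMonoOn (fun y => -((x - y) * (cosh x + 2 * cosh y))) (Ioo 0 x) := by
  refine strictMonoOn_of_hasDerivAt_pos (convex_Ioo 0 x)
    (f' := fun y => cosh x + 2 * cosh y - 2 * (x - y) * sinh y) (fun y hy => ?_)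
    (fun y hy => sub_pos.2 (two_mul_sub_mul_sinh_lt hy.2))
  refine (((hasDerivAt_id y).const_sub x).mul
    (((hasDerivAt_cosh y).const_mul 2).const_add (cosh x))).neg.congr_deriv ?_
  simp
  ring

/-- The equations of a critical point `(x, -y, -y)` with `x, y > 0`. -/
structure SymmCritical (κ x y : ℝ) : Prop where
  pos_x : 0 < x
  pos_y : 0 < y
  eq_x : sinh x = 2 * κ * (cosh x + 2 * cosh y) * (x - y)
  eq_y : sinh y = κ * (cosh x + 2 * cosh y) * (3 * y - x)

namespace SymmCritical

variable {κ x y x' y' : ℝ}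

theorem lt (hκ : 0 < κ) (h : SymmCritical κ x y) : y < x := by
  have h1 := sinh_pos_iff.2 h.pos_x
  have h2 : 0 < 2 * κ * (cosh x + 2 * cosh y) := by
    have := cosh_pos x
    have := cosh_pos y
    positivity
  rw [h.eq_x] at h1
  exact sub_pos.1 ((pos_iff_pos_of_mul_pos h1).1 h2)

theorem compat (h : SymmCritical κ x y) :
    sinh x * (3 * y - x) - 2 * sinh y * (x - y) = 0 := by
  rw [h.eq_x, h.eq_y]; ring

/-- The point `(x', r x')`, on the ray of the first solution and at the abscissa of the second,
mediates the comparison: one monotonicity acts along the ray, the other at fixed abscissa. -/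
theorem not_ratio_lt (hκ : 0 < κ) (h : SymmCritical κ x y) (h' : SymmCritical κ x' y') :
    ¬ y / x < y' / x' := by
  intro hr
  have hx := h.pos_x
  have hx' := h'.pos_x
  have hlt := h.lt hκ
  have hlt' := h'.lt hκ
  have hs := sinh_pos_iff.2 hx
  have hs' := sinh_pos_iff.2 hx'
  obtain ⟨r, hr'⟩ : ∃ r, r = y / x := ⟨_, rfl⟩
  have hy : y = r * x := by rw [hr']; field_simp
  have hr0 : 0 < r := hr' ▸ div_pos h.pos_y hx
  have hr1 : r < 1 := by rw [hr', div_lt_one hx]; exact hlt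
  rw [← hr', lt_div_iff₀ hx'] at hr
  have hmem : r * x' ∈ Ioo 0 x' := ⟨by positivity, by nlinarith⟩
  have hmem' : y' ∈ Ioo 0 x' := ⟨h'.pos_y, hlt'⟩
  -- At `(x', r x')` the compatibility function is negative. Since `sinh (r x) / sinh x` decreases
  -- in `x`, it would also be negative at `(x, r x)` if `x ≤ x'`, where it must vanish.
  have hxx : x' < x := by
    by_contra! hle
    have h1 := (strictMonoOn_sinh_div_sinh hr0 hr1).monotoneOn (mem_Ioi.2 hx) (mem_Ioi.2 hx') hle
    have h2 := strictMonoOn_compat hmem hmem' hr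
    have h3 := h.compat
    simp only [h'.compat] at h2
    simp only [neg_le_neg_iff] at h1
    rw [div_le_div_iff₀ hs' hs] at h1
    rw [hy] at h3
    have h4 : x' * (sinh x' * (3 * r - 1) - 2 * sinh (r * x') * (1 - r)) < 0 := by linarith
    have h5 : sinh x' * (3 * r - 1) - 2 * sinh (r * x') * (1 - r) < 0 := by
      by_contra! hc
      nlinarith
    have h6 : sinh x * (3 * r - 1) - 2 * sinh (r * x) * (1 - r) = 0 := by
      have : x * (sinh x * (3 * r - 1) - 2 * sinh (r * x) * (1 - r)) = 0 := by linarith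
      exact (mul_eq_zero.1 this).resolve_left hx.ne'
    have h7 := mul_lt_mul_of_pos_right h5 hs
    have h8 := mul_le_mul_of_nonneg_left h1 (by linarith : 0 ≤ 2 * (1 - r))
    nlinarith
  -- `(x - y)(cosh x + 2 cosh y) / sinh x` equals `1/(2κ)` at both solutions, yet it falls strictly
  -- from `(x, r x)` to `(x', r x')` and again to `(x', y')`.
  have h1 := strictMonoOn_mul_cosh_add_div_sinh hr0 (mem_Ioi.2 hx') (mem_Ioi.2 hx) hxx
  have h2 := strictMonoOn_neg_sub_mul_cosh_add hmem hmem' hr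
  have e := h.eq_x
  have e' := h'.eq_x
  simp only [neg_lt_neg_iff] at h1 h2
  rw [div_lt_div_iff₀ hs' hs] at h1
  rw [hy] at e
  have hpos : 0 < 2 * κ * (1 - r) := by
    have := sub_pos.2 hr1
    positivity
  have h3 := mul_lt_mul_of_pos_left h1 hpos
  have h4 := mul_lt_mul_of_pos_left h2 (by positivity : 0 < 2 * κ * sinh x)
  have h5 : sinh x' * sinh x = 2 * κ * (1 - r) * (x * (cosh x + 2 * cosh (r * x)) * sinh x') := by
    linear_combination sinh x' * e
  have h6 : sinh x' * sinh x = 2 * κ * sinh x * ((x' - y') * (cosh x' + 2 * cosh y')) := by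
    linear_combination sinh x * e'
  nlinarith

/-- With a common ratio `r`, compatibility prescribes `sinh (r x) / sinh x`, which is injective in
`x`. -/
theorem unique (hκ : 0 < κ) (h : SymmCritical κ x y) (h' : SymmCritical κ x' y') :
    x = x' ∧ y = y' := by
  have hx := h.pos_x
  have hx' := h'.pos_x
  have hlt := h.lt hκ
  have hr : y / x = y' / x' :=
    le_antisymm (not_lt.1 (not_ratio_lt hκ h' h)) (not_lt.1 (not_ratio_lt hκ h h'))
  obtain ⟨r, hr'⟩ : ∃ r, r = y / x := ⟨_, rfl⟩
  have hy : y = r * x := by rw [hr']; field_simp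
  have hy' : y' = r * x' := by rw [hr', hr]; field_simp
  have hr0 : 0 < r := hr' ▸ div_pos h.pos_y hx
  have hr1 : r < 1 := by rw [hr', div_lt_one hx]; exact hlt
  have key : ∀ {x y : ℝ}, SymmCritical κ x y → y = r * x →
      sinh (r * x) / sinh x = (3 * r - 1) / (2 * (1 - r)) := by
    intro x y h hy
    have h3 := h.compat
    rw [hy] at h3
    have : x * (sinh x * (3 * r - 1) - 2 * sinh (r * x) * (1 - r)) = 0 := by linarith
    have := (mul_eq_zero.1 this).resolve_left h.pos_x.ne'
    rw [div_eq_div_iff (sinh_pos_iff.2 h.pos_x).ne' (by linarith)]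
    linarith
  have hxx : x = x' := (strictMonoOn_sinh_div_sinh hr0 hr1).injOn (mem_Ioi.2 hx) (mem_Ioi.2 hx')
    (by simp only [key h hy, key h' hy'])
  exact ⟨hxx, by rw [hy, hy', hxx]⟩

end SymmCritical

/-! ### The second-order condition -/

theorem one_add_sq_half_le_cosh (x : ℝ) : 1 + x ^ 2 / 2 ≤ cosh x := by
  have h := cosh_sq (x / 2)
  have h2 : cosh x = 1 + 2 * sinh (x / 2) ^ 2 := by
    have := cosh_two_mul (x / 2)
    rw [mul_div_cancel₀ _ two_ne_zero] at this
    rw [this, h]; ring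
  have h3 : (x / 2) ^ 2 ≤ sinh (x / 2) ^ 2 := by
    rw [sq_le_sq, abs_sinh]
    exact self_le_sinh_iff.2 (abs_nonneg _)
  rw [h2]; linarith

/-- Averaging the hypothesis over `t` and `-t` removes the odd terms, so quadratic bounds for `cosh`
and `exp` replace second derivatives. -/
theorem second_order {u v : Fin 3 → ℝ} {κ : ℝ} (hκ : 0 ≤ κ)
    (hmax : ∀ t : ℝ, ∑ i, cosh (u i + t * v i)
      ≤ (∑ i, cosh (u i)) * exp (κ * t ^ 2 * (∑ i, v i ^ 2) / 2)) :
    ∑ i, v i ^ 2 * (cosh (u i) - κ * ∑ j, cosh (u j)) ≤ 0 := by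
  set D := ∑ i, cosh (u i) with hD
  set N := ∑ i, v i ^ 2 with hN
  set E := ∑ i, v i ^ 2 * cosh (u i) with hE
  have hD0 : 0 ≤ D := Finset.sum_nonneg fun i _ => (cosh_pos _).le
  have hN0 : 0 ≤ N := Finset.sum_nonneg fun i _ => sq_nonneg _
  have hsum : ∑ i, v i ^ 2 * (cosh (u i) - κ * D) = E - D * (κ * N) := by
    simp only [mul_sub, Finset.sum_sub_distrib, ← Finset.sum_mul]
    ring
  rw [hsum]
  have hlow : ∀ t : ℝ, D + t ^ 2 / 2 * E ≤ D * exp (κ * t ^ 2 * N / 2) := by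
    intro t
    have h1 := hmax t
    have h2 := hmax (-t)
    rw [neg_sq] at h2
    have h3 : ∑ i, cosh (u i + t * v i) + ∑ i, cosh (u i + -t * v i)
        = ∑ i, 2 * (cosh (u i) * cosh (t * v i)) := by
      rw [← Finset.sum_add_distrib]
      refine Finset.sum_congr rfl fun i _ => ?_
      rw [neg_mul, ← sub_eq_add_neg, cosh_add, cosh_sub]; ring
    have h4 : ∑ i, 2 * (cosh (u i) * (1 + (t * v i) ^ 2 / 2))
        ≤ ∑ i, 2 * (cosh (u i) * cosh (t * v i)) := by
      refine Finset.sum_le_sum fun i _ => ?_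
      have := mul_le_mul_of_nonneg_left (one_add_sq_half_le_cosh (t * v i)) (cosh_pos (u i)).le
      linarith
    have h5 : ∑ i, 2 * (cosh (u i) * (1 + (t * v i) ^ 2 / 2)) = 2 * (D + t ^ 2 / 2 * E) := by
      rw [hD, hE, Finset.mul_sum, ← Finset.sum_add_distrib, Finset.mul_sum]
      exact Finset.sum_congr rfl fun i _ => by ring
    linarith
  -- The bound `|exp z - 1 - z| ≤ z²` needs `|z| ≤ 1`. Dividing by `t² / 2` leaves an error that
  -- vanishes as `t → 0`.
  have hup : ∀ t : ℝ, κ * t ^ 2 * N / 2 ≤ 1 → t ≠ 0 → E - D * (κ * N)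
      ≤ D * (κ * N) ^ 2 / 2 * t ^ 2 := by
    intro t ht ht0
    have h0 : 0 ≤ κ * t ^ 2 * N / 2 := by positivity
    have h1 := (abs_le.1 (abs_exp_sub_one_sub_id_le (by rwa [abs_of_nonneg h0]))).2
    have h2 : D * exp (κ * t ^ 2 * N / 2)
        ≤ D * (1 + κ * t ^ 2 * N / 2 + (κ * t ^ 2 * N / 2) ^ 2) :=
      mul_le_mul_of_nonneg_left (by linarith) hD0
    have h3 := hlow t
    have h4 : t ^ 2 / 2 * (E - D * (κ * N)) ≤ t ^ 2 / 2 * (D * (κ * N) ^ 2 / 2 * t ^ 2) := by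
      nlinarith
    exact le_of_mul_le_mul_left h4 (by positivity)
  have hlim : Tendsto (fun t : ℝ => D * (κ * N) ^ 2 / 2 * t ^ 2) (𝓝[≠] 0) (𝓝 0) := by
    have : Continuous fun t : ℝ => D * (κ * N) ^ 2 / 2 * t ^ 2 := by fun_prop
    simpa using (this.tendsto 0).mono_left nhdsWithin_le_nhds
  have hev : ∀ᶠ t : ℝ in 𝓝[≠] 0, κ * t ^ 2 * N / 2 ≤ 1 := by
    have : Continuous fun t : ℝ => κ * t ^ 2 * N / 2 := by fun_prop
    have h := (this.tendsto 0).mono_left (nhdsWithin_le_nhds (s := {0}ᶜ))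
    simp only [ne_eq, OfNat.ofNat_ne_zero, not_false_eq_true, zero_pow, mul_zero, zero_mul,
      zero_div] at h
    exact h.eventually (eventually_le_nhds one_pos)
  refine ge_of_tendsto hlim ?_
  filter_upwards [hev, self_mem_nhdsWithin] with t h1 h2
  exact hup t h1 h2

/-! ### Symmetries -/

/-- The space `ℝ³`. -/
abbrev V3 : Type := EuclideanSpace ℝ (Fin 3)

theorem units_mul_self_real (e : ℤˣ) : ((e : ℤ) : ℝ) * ((e : ℤ) : ℝ) = 1 := by
  rw [← Int.cast_mul, ← Units.val_mul, Int.units_mul_self]; simp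

/-- Permuting the coordinates and changing the global sign. -/
def act (σ : Equiv.Perm (Fin 3)) (e : ℤˣ) : V3 →ₗᵢ[ℝ] V3 where
  toFun s := WithLp.toLp 2 fun i => ((e : ℤ) : ℝ) * s (σ i)
  map_add' s t := by ext i; simp [mul_add]
  map_smul' c s := by ext i; simp; ring
  norm_map' s := by
    simp only [LinearMap.coe_mk, AddHom.coe_mk, EuclideanSpace.norm_eq]
    congr 1
    rw [← Equiv.sum_comp σ fun i => ‖s i‖ ^ 2]
    refine Finset.sum_congr rfl fun i _ => ?_
    rw [norm_mul, mul_pow, Real.norm_eq_abs ((e : ℤ) : ℝ), sq_abs, sq, units_mul_self_real, one_mul]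

theorem act_apply (σ : Equiv.Perm (Fin 3)) (e : ℤˣ) (s : V3) (i : Fin 3) :
    act σ e s i = ((e : ℤ) : ℝ) * s (σ i) := rfl

theorem sameOrbit_iff {s t : V3} : SameOrbit s t ↔ ∃ σ e, t = act σ e s := by
  refine exists_congr fun σ => exists_congr fun e => ?_
  constructor
  · intro h; ext i; exact h i
  · rintro rfl i; rfl

theorem act_symm_act (σ : Equiv.Perm (Fin 3)) (e : ℤˣ) (s : V3) :
    act σ.symm e (act σ e s) = s := by
  ext i
  rw [act_apply, act_apply, ← mul_assoc, units_mul_self_real, one_mul, Equiv.apply_symm_apply]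

theorem act_act_symm (σ : Equiv.Perm (Fin 3)) (e : ℤˣ) (s : V3) :
    act σ e (act σ.symm e s) = s := by
  simpa using act_symm_act σ.symm e s

theorem act_act (σ τ : Equiv.Perm (Fin 3)) (e d : ℤˣ) (s : V3) :
    act τ d (act σ e s) = act (σ * τ) (d * e) s := by
  ext i
  simp only [act_apply, Equiv.Perm.mul_apply, Units.val_mul, Int.cast_mul]
  ring

/-- The action of the symmetries on votes. -/
def actVote (σ : Equiv.Perm (Fin 3)) (e : ℤˣ) : NAE3 ≃ NAE3 where
  toFun x := ⟨fun i => e * x.1 (σ i), by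
    have key : ∀ d : ℤˣ, (fun i => e * x.1 (σ i)) = (fun _ => d) → x.1 = fun _ => e * d := by
      intro d h
      funext i
      have := congrFun h (σ.symm i)
      simp only [Equiv.apply_symm_apply] at this
      rw [← this, ← mul_assoc, Int.units_mul_self, one_mul]
    constructor <;> intro h <;> have h' := key _ h <;>
      rcases Int.units_eq_one_or e with rfl | rfl
    · exact x.2.1 (by simpa using h')
    · exact x.2.2 (by simpa using h')
    · exact x.2.2 (by simpa using h')
    · exact x.2.1 (by simpa using h')⟩
  invFun x := ⟨fun i => e * x.1 (σ.symm i), by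
    have key : ∀ d : ℤˣ, (fun i => e * x.1 (σ.symm i)) = (fun _ => d) → x.1 = fun _ => e * d := by
      intro d h
      funext i
      have := congrFun h (σ i)
      simp only [Equiv.symm_apply_apply] at this
      rw [← this, ← mul_assoc, Int.units_mul_self, one_mul]
    constructor <;> intro h <;> have h' := key _ h <;>
      rcases Int.units_eq_one_or e with rfl | rfl
    · exact x.2.1 (by simpa using h')
    · exact x.2.2 (by simpa using h')
    · exact x.2.2 (by simpa using h')
    · exact x.2.1 (by simpa using h')⟩
  left_inv x := by
    apply Subtype.ext
    funext i
    simp only [Equiv.apply_symm_apply]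
    rw [← mul_assoc, Int.units_mul_self, one_mul]
  right_inv x := by
    apply Subtype.ext
    funext i
    simp only [Equiv.symm_apply_apply]
    rw [← mul_assoc, Int.units_mul_self, one_mul]

theorem vec_actVote (σ : Equiv.Perm (Fin 3)) (e : ℤˣ) (x : NAE3) :
    (actVote σ e x).vec = act σ e x.vec := by
  ext i
  have h : (actVote σ e x).vec i = (((e * x.1 (σ i) : ℤˣ) : ℤ) : ℝ) := rfl
  have h' : x.vec (σ i) = ((x.1 (σ i) : ℤ) : ℝ) := rfl
  rw [h, act_apply, h', Units.val_mul, Int.cast_mul]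

/-! ### The Gibbs variational principle -/

/-- The moment generating function of the sum over votes. -/
noncomputable def mgfSum (l : V3) : ℝ := ∑ x : NAE3, exp (inner ℝ l x.vec)

theorem mgfSum_pos (l : V3) : 0 < mgfSum l :=
  Finset.sum_pos (fun _ _ => exp_pos _) Finset.univ_nonempty

/-- The Gibbs distribution with external field `l`. -/
noncomputable def gibbs (l : V3) (x : NAE3) : ℝ := exp (inner ℝ l x.vec) / mgfSum l

theorem gibbs_pos (l : V3) (x : NAE3) : 0 < gibbs l x := div_pos (exp_pos _) (mgfSum_pos l)

theorem sum_gibbs (l : V3) : ∑ x, gibbs l x = 1 := by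
  simp only [gibbs, ← Finset.sum_div]
  exact div_self (mgfSum_pos l).ne'

theorem gibbs_mem (l : V3) : gibbs l ∈ stdSimplex ℝ NAE3 :=
  ⟨fun x => (gibbs_pos l x).le, sum_gibbs l⟩

theorem log_gibbs (l : V3) (x : NAE3) :
    log (gibbs l x) = inner ℝ l x.vec - log (mgfSum l) := by
  rw [gibbs, log_div (exp_pos _).ne' (mgfSum_pos l).ne', log_exp]

theorem inner_mean (l : V3) (p : NAE3 → ℝ) :
    inner ℝ l (mean p) = ∑ x, p x * inner ℝ l x.vec := by
  simp only [mean, inner_sum, inner_smul_right]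

theorem sum_mul_log_gibbs (l : V3) {p : NAE3 → ℝ} (hp : p ∈ stdSimplex ℝ NAE3) :
    ∑ x, p x * log (gibbs l x) = inner ℝ l (mean p) - log (mgfSum l) := by
  simp only [log_gibbs, mul_sub, Finset.sum_sub_distrib, ← Finset.sum_mul, hp.2, one_mul,
    inner_mean]

theorem negMulLog_add_mul_log_le {p q : ℝ} (hp : 0 ≤ p) (hq : 0 < q) :
    negMulLog p + p * log q ≤ q - p := by
  rcases hp.eq_or_lt with rfl | hp
  · simpa using hq.le
  · have h := log_le_sub_one_of_pos (div_pos hq hp)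
    rw [log_div hq.ne' hp.ne'] at h
    have h2 := mul_le_mul_of_nonneg_left h hp.le
    rw [mul_sub, mul_sub, mul_div_cancel₀ _ hp.ne'] at h2
    rw [negMulLog]
    linarith

/-- The deficit is the relative entropy of `p` with respect to `gibbs l`. -/
theorem entropy_add_inner_le (l : V3) {p : NAE3 → ℝ} (hp : p ∈ stdSimplex ℝ NAE3) :
    entropy p + inner ℝ l (mean p) ≤ log (mgfSum l) := by
  have h : ∑ x, (negMulLog (p x) + p x * log (gibbs l x)) ≤ ∑ x, (gibbs l x - p x) :=
    Finset.sum_le_sum fun x _ => negMulLog_add_mul_log_le (hp.1 x) (gibbs_pos l x)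
  rw [Finset.sum_add_distrib, Finset.sum_sub_distrib, sum_gibbs, hp.2, sum_mul_log_gibbs l hp] at h
  unfold entropy
  linarith

theorem entropy_gibbs_add_inner (l : V3) :
    entropy (gibbs l) + inner ℝ l (mean (gibbs l)) = log (mgfSum l) := by
  have h : ∑ x, (negMulLog (gibbs l x) + gibbs l x * log (gibbs l x)) = 0 :=
    Finset.sum_eq_zero fun x _ => by simp [negMulLog]
  rw [Finset.sum_add_distrib, sum_mul_log_gibbs l (gibbs_mem l)] at h
  unfold entropy
  linarith

/-- The dual form of the mean-field functional. -/
noncomputable def Psi (β : ℝ) (s : V3) : ℝ := log (mgfSum (β • s)) - β / 2 * ‖s‖ ^ 2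

theorem Phi_le_Psi (β : ℝ) (s : V3) : Phi β s ≤ (Psi β s : EReal) := by
  have h : (⨆ p ∈ {p : NAE3 → ℝ | p ∈ stdSimplex ℝ NAE3 ∧ mean p = s}, (entropy p : EReal))
      ≤ ((Psi β s - β / 2 * ‖s‖ ^ 2 : ℝ) : EReal) := by
    refine iSup₂_le fun p hp => ?_
    obtain ⟨hp, rfl⟩ := hp
    rw [EReal.coe_le_coe_iff]
    have := entropy_add_inner_le (β • mean p) hp
    rw [inner_smul_left, real_inner_self_eq_norm_sq] at this
    simp only [conj_trivial] at this
    unfold Psi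
    linarith
  calc Phi β s ≤ ((β / 2 * ‖s‖ ^ 2 : ℝ) : EReal) + ((Psi β s - β / 2 * ‖s‖ ^ 2 : ℝ) : EReal) :=
        add_le_add_right h _
    _ = (Psi β s : EReal) := by rw [← EReal.coe_add]; congr 1; ring

theorem le_Phi (β : ℝ) {p : NAE3 → ℝ} (hp : p ∈ stdSimplex ℝ NAE3) :
    ((β / 2 * ‖mean p‖ ^ 2 + entropy p : ℝ) : EReal) ≤ Phi β (mean p) := by
  rw [EReal.coe_add]
  exact add_le_add_right (le_iSup₂_of_le (f := fun (q : NAE3 → ℝ)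
    (_ : q ∈ {q : NAE3 → ℝ | q ∈ stdSimplex ℝ NAE3 ∧ mean q = mean p}) => (entropy q : EReal))
    p ⟨hp, rfl⟩ le_rfl) _

/-- One step of the mean-field iteration. -/
noncomputable def meanFieldMap (β : ℝ) (s : V3) : V3 := mean (gibbs (β • s))

/-- Equality in Gibbs' inequality followed by completing the square. The right side is a competitor
for `Phi` at the image point, so a mean-field step strictly raises the functional away from fixed
points when `β > 0`. -/
theorem Psi_add_eq (β : ℝ) (s : V3) :
    Psi β s + β / 2 * ‖meanFieldMap β s - s‖ ^ 2
      = β / 2 * ‖meanFieldMap β s‖ ^ 2 + entropy (gibbs (β • s)) := by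
  have h := entropy_gibbs_add_inner (β • s)
  rw [inner_smul_left] at h
  simp only [conj_trivial] at h
  rw [norm_sub_sq_real, real_inner_comm, Psi, ← h, meanFieldMap]
  ring

theorem Psi_add_le_Phi (β : ℝ) (s : V3) :
    ((Psi β s + β / 2 * ‖meanFieldMap β s - s‖ ^ 2 : ℝ) : EReal) ≤ Phi β (meanFieldMap β s) := by
  rw [Psi_add_eq]
  exact le_Phi β (gibbs_mem _)

theorem Psi_add_le (β : ℝ) (s : V3) :
    Psi β s + β / 2 * ‖meanFieldMap β s - s‖ ^ 2 ≤ Psi β (meanFieldMap β s) :=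
  EReal.coe_le_coe_iff.1 ((Psi_add_le_Phi β s).trans (Phi_le_Psi β _))

theorem norm_vec_le (x : NAE3) : ‖x.vec‖ ≤ 2 := by
  have h : ∀ e : ℤˣ, ‖((e : ℤ) : ℝ)‖ ^ 2 = 1 := fun e => by
    rw [Real.norm_eq_abs, sq_abs, sq, units_mul_self_real]
  rw [EuclideanSpace.norm_eq, Real.sqrt_le_left two_pos.le, Fin.sum_univ_three]
  simp only [NAE3.vec, h]
  norm_num

theorem norm_mean_le {p : NAE3 → ℝ} (hp : p ∈ stdSimplex ℝ NAE3) : ‖mean p‖ ≤ 2 := by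
  calc ‖mean p‖ ≤ ∑ x, ‖p x • x.vec‖ := norm_sum_le _ _
    _ ≤ ∑ x, p x * 2 := Finset.sum_le_sum fun x _ => by
        rw [norm_smul, Real.norm_of_nonneg (hp.1 x)]
        exact mul_le_mul_of_nonneg_left (norm_vec_le x) (hp.1 x)
    _ = 2 := by rw [← Finset.sum_mul, hp.2, one_mul]

theorem continuous_Psi (β : ℝ) : Continuous (Psi β) := by
  have h : Continuous fun s : V3 => mgfSum (β • s) := by
    unfold mgfSum
    fun_prop
  exact (h.log fun s => (mgfSum_pos _).ne').sub (by fun_prop)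

/-- A mean-field step does not decrease `Psi` and lands in the ball of radius 2, so a maximum over
that ball is global. -/
theorem exists_forall_Psi_le {β : ℝ} (hβ : 0 < β) : ∃ s, ∀ t, Psi β t ≤ Psi β s := by
  obtain ⟨s, -, hs⟩ := (isCompact_closedBall (0 : V3) 2).exists_isMaxOn
    ⟨0, by simp⟩ (continuous_Psi β).continuousOn
  refine ⟨s, fun t => ?_⟩
  have h1 := Psi_add_le β t
  have h2 : Psi β (meanFieldMap β t) ≤ Psi β s :=
    hs (by simpa using! norm_mean_le (gibbs_mem (β • t)))
  have : 0 ≤ β / 2 * ‖meanFieldMap β t - t‖ ^ 2 := by positivity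
  linarith

theorem meanFieldMap_eq_self {β : ℝ} (hβ : 0 < β) {s : V3} (hs : ∀ t, Psi β t ≤ Psi β s) :
    meanFieldMap β s = s := by
  have h1 := Psi_add_le β s
  have h2 := hs (meanFieldMap β s)
  have h3 : ‖meanFieldMap β s - s‖ ^ 2 ≤ 0 := by
    by_contra! hc
    have : 0 < β / 2 * ‖meanFieldMap β s - s‖ ^ 2 := by positivity
    linarith
  have h4 : ‖meanFieldMap β s - s‖ = 0 := by
    have := le_antisymm h3 (sq_nonneg _)
    exact pow_eq_zero_iff two_ne_zero |>.1 this
  exact sub_eq_zero.1 (norm_eq_zero.1 h4)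

/-- `Phi ≤ Psi` everywhere, with equality at the maximizers of `Psi` because these are fixed points.
-/
theorem mem_globalMaximizers_iff {β : ℝ} (hβ : 0 < β) {s : V3} :
    s ∈ globalMaximizers β ↔ ∀ t, Psi β t ≤ Psi β s := by
  have key : ∀ s : V3, (∀ t, Psi β t ≤ Psi β s) → (Psi β s : EReal) ≤ Phi β s := by
    intro s hs
    have h := Psi_add_le_Phi β s
    rw [meanFieldMap_eq_self hβ hs] at h
    simpa using h
  constructor
  · intro hs
    obtain ⟨s₀, hs₀⟩ := exists_forall_Psi_le hβ
    have : Psi β s₀ ≤ Psi β s :=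
      EReal.coe_le_coe_iff.1 ((key s₀ hs₀).trans ((hs s₀).trans (Phi_le_Psi β s)))
    exact fun t => (hs₀ t).trans this
  · intro hs t
    exact (Phi_le_Psi β t).trans ((EReal.coe_le_coe_iff.2 (hs t)).trans (key s hs))

/-! ### Equivariance -/

theorem inner_act_vec (σ : Equiv.Perm (Fin 3)) (e : ℤˣ) (l : V3) (x : NAE3) :
    inner ℝ (act σ e l) (actVote σ e x).vec = inner ℝ l x.vec := by
  rw [vec_actVote, LinearIsometry.inner_map_map]

theorem mgfSum_act (σ : Equiv.Perm (Fin 3)) (e : ℤˣ) (l : V3) :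
    mgfSum (act σ e l) = mgfSum l := by
  unfold mgfSum
  rw [← Equiv.sum_comp (actVote σ e)]
  simp only [inner_act_vec]

theorem Psi_act (β : ℝ) (σ : Equiv.Perm (Fin 3)) (e : ℤˣ) (s : V3) :
    Psi β (act σ e s) = Psi β s := by
  rw [Psi, ← map_smul, mgfSum_act, LinearIsometry.norm_map, Psi]

theorem meanFieldMap_act (β : ℝ) (σ : Equiv.Perm (Fin 3)) (e : ℤˣ) (s : V3) :
    meanFieldMap β (act σ e s) = act σ e (meanFieldMap β s) := by
  unfold meanFieldMap mean
  rw [map_sum, ← Equiv.sum_comp (actVote σ e)]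
  refine Finset.sum_congr rfl fun x _ => ?_
  rw [map_smul, ← map_smul (act σ e) β s, gibbs, gibbs, inner_act_vec, mgfSum_act, vec_actVote]

theorem act_mem_globalMaximizers {β : ℝ} (hβ : 0 < β) (σ : Equiv.Perm (Fin 3)) (e : ℤˣ) {s : V3}
    (hs : s ∈ globalMaximizers β) : act σ e s ∈ globalMaximizers β := by
  rw [mem_globalMaximizers_iff hβ] at hs ⊢
  intro t
  rw [Psi_act]
  exact hs t

/-! ### Coordinates -/

/-- The vote whose coordinates are `e`, except for the coordinate `2 - i`, which is `-e`. -/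
def pole (i : Fin 3) (e : ℤˣ) : NAE3 :=
  ⟨fun j => if j = i.rev then -e else e, by revert i e; decide⟩

theorem pole_bijective : Function.Bijective fun q : Fin 3 × ℤˣ => pole q.1 q.2 := by
  constructor
  · unfold Function.Injective; decide
  · unfold Function.Surjective; decide

theorem sum_NAE3 {M : Type*} [AddCommMonoid M] (f : NAE3 → M) :
    ∑ x, f x = ∑ i, (f (pole i 1) + f (pole i (-1))) := by
  rw [← pole_bijective.sum_comp f, Fintype.sum_prod_type]
  refine Finset.sum_congr rfl fun i _ => ?_
  have : (Finset.univ : Finset ℤˣ) = {1, -1} := by decide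
  rw [this, Finset.sum_pair (by decide)]

theorem vec_pole (i j : Fin 3) (e : ℤˣ) :
    (pole i e).vec j = (if j = i.rev then -1 else 1) * ((e : ℤ) : ℝ) := by
  have h : (pole i e).vec j = (((if j = i.rev then -e else e : ℤˣ) : ℤ) : ℝ) := rfl
  rw [h]
  split_ifs <;> simp

/-- The values of a linear functional on three of the votes; the others are opposite. -/
def field (l : V3) : Fin 3 → ℝ :=
  ![l 0 + l 1 - l 2, l 0 - l 1 + l 2, -l 0 + l 1 + l 2]

theorem inner_pole (l : V3) (i : Fin 3) (e : ℤˣ) :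
    inner ℝ l (pole i e).vec = ((e : ℤ) : ℝ) * field l i := by
  rw [PiLp.inner_apply, Fin.sum_univ_three]
  simp only [vec_pole]
  fin_cases i <;> simp [field, Fin.rev, Fin.ext_iff] <;> ring

theorem mgfSum_eq (l : V3) : mgfSum l = 2 * ∑ i, cosh (field l i) := by
  rw [mgfSum, sum_NAE3, Finset.mul_sum]
  refine Finset.sum_congr rfl fun i _ => ?_
  rw [inner_pole, inner_pole, cosh_eq]
  simp
  ring

theorem mean_gibbs_apply (l : V3) (j : Fin 3) :
    mean (gibbs l) j
      = (∑ i, (if j = i.rev then -1 else 1) * sinh (field l i)) / ∑ i, cosh (field l i) := by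
  have hD : 0 < ∑ i, cosh (field l i) :=
    Finset.sum_pos (fun _ _ => cosh_pos _) Finset.univ_nonempty
  have h : mean (gibbs l) j = ∑ x, gibbs l x * x.vec j := by
    simp [mean]
  rw [h, sum_NAE3, Finset.sum_div]
  refine Finset.sum_congr rfl fun i _ => ?_
  rw [vec_pole, vec_pole, gibbs, gibbs, mgfSum_eq, inner_pole, inner_pole, sinh_eq]
  simp only [Units.val_one, Int.cast_one, one_mul, Units.val_neg, Int.cast_neg]
  field_simp
  ring

theorem meanFieldEquations_iff {β : ℝ} {s : V3} :
    MeanFieldEquations β s ↔ meanFieldMap β s = s := by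
  have h : meanFieldMap β s = s ↔ ∀ j, s j = mean (gibbs (β • s)) j := by
    constructor
    · intro h j; exact congrArg (fun t : V3 => t j) h.symm
    · intro h; ext j; exact (h j).symm
  have hl : ∀ j, (β • s) j = β * s j := fun j => rfl
  rw [h, Fin.forall_fin_succ, Fin.forall_fin_succ, Fin.forall_fin_succ]
  simp only [mean_gibbs_apply, Fin.sum_univ_three, field, MeanFieldEquations]
  simp only [Fin.rev, Fin.ext_iff, Matrix.cons_val_zero, Matrix.cons_val_one, Matrix.cons_val_two,
    Matrix.head_cons, Matrix.tail_cons, hl, IsEmpty.forall_iff, and_true]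
  norm_num
  constructor
  · rintro ⟨l, hl, h⟩
    obtain rfl : l = fun i => β * s i := funext hl
    refine ⟨h.1.trans ?_, h.2.1.trans ?_, h.2.2.trans ?_⟩ <;> ring
  · rintro ⟨h1, h2, h3⟩
    refine ⟨fun i => β * s i, fun _ => rfl, h1.trans ?_, h2.trans ?_, h3.trans ?_⟩ <;> ring

/-! ### The functional in terms of the fields -/

/-- The sum of the hyperbolic cosines of the fields. -/
noncomputable def coshSum (u : Fin 3 → ℝ) : ℝ := ∑ i, cosh (u i)

/-- The quadratic form of the dual functional. -/
def fieldQuad (u : Fin 3 → ℝ) : ℝ := ∑ i, u i ^ 2 + (∑ i, u i) ^ 2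

/-- `u` maximizes the dual functional. -/
def IsMaxField (κ : ℝ) (u : Fin 3 → ℝ) : Prop :=
  ∀ w, coshSum w ≤ coshSum u * exp (κ / 2 * (fieldQuad w - fieldQuad u))

/-- `u` is a critical point of the dual functional. -/
def IsCritField (κ : ℝ) (u : Fin 3 → ℝ) : Prop :=
  ∀ i, sinh (u i) = κ * coshSum u * (u i + ∑ j, u j)

theorem coshSum_pos (u : Fin 3 → ℝ) : 0 < coshSum u :=
  Finset.sum_pos (fun _ _ => cosh_pos _) Finset.univ_nonempty

/-- Each coordinate of `l` is half a sum of two entries of `u = field l`, so `4‖l‖² = fieldQuad u`;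
with `l = β • s` this is the source of `1 / (4β)`. -/
theorem Psi_eq {β : ℝ} (hβ : 0 < β) (s : V3) :
    Psi β s = log 2 + (log (coshSum (field (β • s)))
      - 1 / (4 * β) / 2 * fieldQuad (field (β • s))) := by
  have h : β / 2 * ‖s‖ ^ 2 = 1 / (4 * β) / 2 * fieldQuad (field (β • s)) := by
    rw [EuclideanSpace.norm_sq_eq]
    simp only [fieldQuad, field, Fin.sum_univ_three, Matrix.cons_val_zero, Matrix.cons_val_one,
      Matrix.cons_val_two, Matrix.head_cons, Matrix.tail_cons, PiLp.smul_apply, smul_eq_mul,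
      Real.norm_eq_abs, sq_abs]
    field_simp
    ring
  rw [Psi, h, mgfSum_eq]
  change log (2 * coshSum _) - _ = _
  rw [log_mul two_ne_zero (coshSum_pos _).ne']
  ring

theorem exists_field_eq {β : ℝ} (hβ : 0 < β) (u : Fin 3 → ℝ) : ∃ s : V3, field (β • s) = u := by
  refine ⟨WithLp.toLp 2 ![(u 0 + u 1) / (2 * β), (u 0 + u 2) / (2 * β), (u 1 + u 2) / (2 * β)], ?_⟩
  funext i
  fin_cases i <;> simp [field] <;> field_simp <;> ring

theorem isMaxField_of_mem {β : ℝ} (hβ : 0 < β) {s : V3} (hs : s ∈ globalMaximizers β) :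
    IsMaxField (1 / (4 * β)) (field (β • s)) := by
  intro w
  obtain ⟨t, rfl⟩ := exists_field_eq hβ w
  have h := (mem_globalMaximizers_iff hβ).1 hs t
  rw [Psi_eq hβ, Psi_eq hβ] at h
  rw [← log_le_log_iff (coshSum_pos _) (mul_pos (coshSum_pos _) (exp_pos _)),
    log_mul (coshSum_pos _).ne' (exp_pos _).ne', log_exp]
  linarith

/-- Adding two mean-field equations isolates a single `sinh`, while each `uᵢ + ∑ uⱼ` is `2β` times
the matching sum of two coordinates of `s`. -/
theorem isCritField_of_fixed {β : ℝ} (hβ : 0 < β) {s : V3} (hs : meanFieldMap β s = s) :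
    IsCritField (1 / (4 * β)) (field (β • s)) := by
  have h : ∀ j, s j = mean (gibbs (β • s)) j := fun j => congrArg (fun t : V3 => t j) hs.symm
  have hD := coshSum_pos (field (β • s))
  have h' : ∀ j, s j * coshSum (field (β • s))
      = ∑ i, (if j = i.rev then -1 else 1) * sinh (field (β • s) i) := by
    intro j
    nth_rewrite 1 [h j]
    rw [mean_gibbs_apply]
    exact div_mul_cancel₀ _ hD.ne'
  have h0 := h' 0
  have h1 := h' 1
  have h2 := h' 2
  have e : ∀ i, β * (s i) = (β • s) i := fun _ => rfl
  have hU : ∑ j, field (β • s) j = β * s 0 + β * s 1 + β * s 2 := by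
    rw [Fin.sum_univ_three]
    simp only [field, e, Matrix.cons_val_zero, Matrix.cons_val_one, Matrix.cons_val_two,
      Matrix.head_cons, Matrix.tail_cons]
    ring
  have g0 : field (β • s) 0 = β * s 0 + β * s 1 - β * s 2 := rfl
  have g1 : field (β • s) 1 = β * s 0 - β * s 1 + β * s 2 := rfl
  have g2 : field (β • s) 2 = -(β * s 0) + β * s 1 + β * s 2 := rfl
  simp only [Fin.sum_univ_three, Fin.rev, Fin.ext_iff] at h0 h1 h2
  norm_num at h0 h1 h2
  have key : ∀ a : ℝ, 1 / (4 * β) * coshSum (field (β • s)) * (2 * β * a)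
      = a * coshSum (field (β • s)) / 2 := by
    intro a; field_simp; ring
  intro i
  rw [hU]
  fin_cases i
  · simp only [Fin.zero_eta]
    rw [show field (β • s) 0 + (β * s 0 + β * s 1 + β * s 2) = 2 * β * (s 0 + s 1) by
      rw [g0]; ring, key]
    linarith
  · simp only [Fin.mk_one]
    rw [show field (β • s) 1 + (β * s 0 + β * s 1 + β * s 2) = 2 * β * (s 0 + s 2) by
      rw [g1]; ring, key]
    linarith
  · simp only [Fin.reduceFinMk]
    rw [show field (β • s) 2 + (β * s 0 + β * s 1 + β * s 2) = 2 * β * (s 1 + s 2) by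
      rw [g2]; ring, key]
    linarith

/-! ### The shape of the maximizers -/

section Shape

variable {κ : ℝ} {u : Fin 3 → ℝ}

theorem IsMaxField.comp_perm (h : IsMaxField κ u) (σ : Equiv.Perm (Fin 3)) :
    IsMaxField κ (u ∘ σ) := by
  have h1 : coshSum (u ∘ σ) = coshSum u := Equiv.sum_comp σ fun i => cosh (u i)
  have h2 : fieldQuad (u ∘ σ) = fieldQuad u := by
    unfold fieldQuad
    simp only [Function.comp_apply]
    rw [Equiv.sum_comp σ u, Equiv.sum_comp σ fun i => u i ^ 2]
  intro w
  rw [h1, h2]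
  exact h w

theorem IsCritField.comp_perm (h : IsCritField κ u) (σ : Equiv.Perm (Fin 3)) :
    IsCritField κ (u ∘ σ) := by
  have h1 : coshSum (u ∘ σ) = coshSum u := Equiv.sum_comp σ fun i => cosh (u i)
  intro i
  simp only [Function.comp_apply]
  rw [h1, Equiv.sum_comp σ u]
  exact h (σ i)

/-- In directions orthogonal to both `u` and `(1,1,1)`, `fieldQuad` has no linear term and its
increment is exactly `t² ∑ vᵢ²`. -/
theorem IsMaxField.second_order_le (hκ : 0 ≤ κ) (h : IsMaxField κ u) {v : Fin 3 → ℝ}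
    (hv : ∑ i, v i = 0) (hvu : ∑ i, u i * v i = 0) :
    ∑ i, v i ^ 2 * (cosh (u i) - κ * coshSum u) ≤ 0 := by
  refine second_order hκ fun t => ?_
  have h1 := h fun i => u i + t * v i
  have h2 : fieldQuad (fun i => u i + t * v i) - fieldQuad u = t ^ 2 * ∑ i, v i ^ 2 := by
    simp only [Fin.sum_univ_three, fieldQuad] at hv hvu ⊢
    linear_combination 2 * t * hvu + t * (2 * (u 0 + u 1 + u 2) + t * (v 0 + v 1 + v 2)) * hv
  rw [h2] at h1
  have h3 : κ * t ^ 2 * (∑ i, v i ^ 2) / 2 = κ / 2 * (t ^ 2 * ∑ i, v i ^ 2) := by ring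
  rw [h3]
  exact h1

/-- The direction is `u × (1,1,1)` up to sign; its squared entries are the weights in
`collinear_sinh_pos`, applied to the line of slope `κ * coshSum u`. -/
theorem IsMaxField.two_equal (hκ : 0 ≤ κ) (h : IsMaxField κ u) (hc : IsCritField κ u) :
    u 0 = u 1 ∨ u 1 = u 2 ∨ u 2 = u 0 := by
  by_contra! hne
  have h1 := h.second_order_le hκ (v := ![u 1 - u 2, u 2 - u 0, u 0 - u 1])
    (by simp [Fin.sum_univ_three]) (by simp [Fin.sum_univ_three]; ring)
  have hl : ∀ i, sinh (u i) = κ * coshSum u * u i + κ * coshSum u * ∑ j, u j := fun i => by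
    rw [hc i]; ring
  have h2 := collinear_sinh_pos_of_ne hne.1 hne.2.1 hne.2.2 (hl 0) (hl 1) (hl 2)
  simp [Fin.sum_univ_three] at h1
  linarith

/-- If one entry vanishes, criticality forces the origin, where the second variation along
`(0,1,-1)` is `2(1 - 3κ) > 0`. If `x * y > 0`, replacing `x` by `-x` keeps `coshSum` and lowers
`fieldQuad` by `8xy`. -/
theorem IsMaxField.mul_neg {x y : ℝ} (hκ : 0 < κ) (hκ' : κ < 1 / 3) (h : IsMaxField κ ![x, y, y])
    (hc : IsCritField κ ![x, y, y]) : x * y < 0 := by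
  have hD := coshSum_pos ![x, y, y]
  have h0 := hc 0
  have h1 := hc 1
  simp only [Fin.sum_univ_three, Matrix.cons_val_zero, Matrix.cons_val_one, Matrix.cons_val_two,
    Matrix.head_cons, Matrix.tail_cons] at h0 h1
  have hκD : κ * coshSum ![x, y, y] ≠ 0 := (mul_pos hκ hD).ne'
  have hx0 : x ≠ 0 := by
    rintro rfl
    rw [sinh_zero] at h0
    have : y = 0 := by
      have := (mul_eq_zero.1 h0.symm).resolve_left hκD
      linarith
    subst this
    have h2 := h.second_order_le hκ.le (v := ![0, 1, -1]) (by simp [Fin.sum_univ_three])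
      (by simp [Fin.sum_univ_three])
    simp [Fin.sum_univ_three, coshSum] at h2
    linarith
  have hy0 : y ≠ 0 := by
    rintro rfl
    rw [sinh_zero] at h1
    have := (mul_eq_zero.1 h1.symm).resolve_left hκD
    apply hx0
    linarith
  by_contra! hxy
  have hxy : 0 < x * y := lt_of_le_of_ne hxy (mul_ne_zero hx0 hy0).symm
  have h3 := h ![-x, y, y]
  have h4 : coshSum ![-x, y, y] = coshSum ![x, y, y] := by
    simp [coshSum, Fin.sum_univ_three]
  have h5 : fieldQuad ![-x, y, y] - fieldQuad ![x, y, y] = -(8 * (x * y)) := by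
    simp [fieldQuad, Fin.sum_univ_three]; ring
  rw [h4, h5] at h3
  have h6 : exp (κ / 2 * -(8 * (x * y))) < 1 := by
    rw [exp_lt_one_iff]
    have := mul_pos hκ hxy
    linarith
  nlinarith

/-- The first critical equation reads `sinh x = 2κD(x + y)`, with `D` the `coshSum`, so `x + y` has
the sign of `x`. -/
theorem IsMaxField.add_mul_neg {x y : ℝ} (hκ : 0 < κ) (hκ' : κ < 1 / 3)
    (h : IsMaxField κ ![x, y, y]) (hc : IsCritField κ ![x, y, y]) : (x + y) * y < 0 := by
  have hxy := h.mul_neg hκ hκ' hc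
  have hD := mul_pos hκ (coshSum_pos ![x, y, y])
  have h0 := hc 0
  simp only [Fin.sum_univ_three, Matrix.cons_val_zero, Matrix.cons_val_one, Matrix.cons_val_two,
    Matrix.head_cons, Matrix.tail_cons] at h0
  rcases lt_trichotomy x 0 with hx | rfl | hx
  · have h1 := sinh_neg_iff.2 hx
    have : x + y < 0 := by
      by_contra! hc
      nlinarith
    nlinarith
  · simp at hxy
  · have h1 := sinh_pos_iff.2 hx
    have : 0 < x + y := by
      by_contra! hc
      nlinarith
    nlinarith

end Shape

theorem twoEqualOneOpposite_of_mem {β : ℝ} (hβ : 3 / 4 < β) {s : V3}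
    (hs : s ∈ globalMaximizers β) : TwoEqualOneOpposite s := by
  have hβ0 : 0 < β := by linarith
  have hκ : 0 < 1 / (4 * β) := by positivity
  have hκ' : 1 / (4 * β) < 1 / 3 := by
    rw [div_lt_div_iff₀ (by positivity) (by norm_num)]; linarith
  have hmax := isMaxField_of_mem hβ0 hs
  have hcrit := isCritField_of_fixed hβ0
    (meanFieldMap_eq_self hβ0 ((mem_globalMaximizers_iff hβ0).1 hs))
  have g0 : field (β • s) 0 = β * s 0 + β * s 1 - β * s 2 := rfl
  have g1 : field (β • s) 1 = β * s 0 - β * s 1 + β * s 2 := rfl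
  have g2 : field (β • s) 2 = -(β * s 0) + β * s 1 + β * s 2 := rfl
  -- Here `a` is the repeated coordinate of `s` and `b` the odd one, so `(x + y) * y = 2β² * a * b`.
  have key : ∀ (σ : Equiv.Perm (Fin 3)) {x y a b : ℝ}, field (β • s) ∘ σ = ![x, y, y] →
      x + y = 2 * β * a → y = β * b → a * b < 0 := by
    intro σ x y a b e ea eb
    have h1 := hmax.comp_perm σ
    have h2 := hcrit.comp_perm σ
    rw [e] at h1 h2
    have h3 := h1.add_mul_neg hκ hκ' h2
    rw [ea, eb] at h3
    by_contra! hc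
    have : 0 ≤ 2 * β * β * (a * b) := by positivity
    nlinarith
  rcases hmax.two_equal hκ.le hcrit with h | h | h
  · have h' : s 1 = s 2 := by
      rw [g0, g1] at h
      have : β * s 1 = β * s 2 := by linarith
      exact mul_left_cancel₀ hβ0.ne' this
    refine ⟨Equiv.swap 0 2, ?_⟩
    have e0 : (Equiv.swap 0 2 : Equiv.Perm (Fin 3)) 0 = 2 := by decide
    have e1 : (Equiv.swap 0 2 : Equiv.Perm (Fin 3)) 1 = 1 := by decide
    have e2 : (Equiv.swap 0 2 : Equiv.Perm (Fin 3)) 2 = 0 := by decide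
    rw [e0, e1, e2]
    refine ⟨h'.symm, key (Equiv.swap 0 2) (x := field (β • s) 2) (y := field (β • s) 0) ?_ ?_ ?_⟩
    · funext i
      fin_cases i
      · exact congrArg _ e0
      · exact (congrArg _ e1).trans h.symm
      · exact congrArg _ e2
    · rw [g0, g2, h']; ring
    · rw [g0, h']; ring
  · have h' : s 0 = s 1 := by
      rw [g1, g2] at h
      have : β * s 0 = β * s 1 := by linarith
      exact mul_left_cancel₀ hβ0.ne' this
    refine ⟨1, h', key 1 (x := field (β • s) 0) (y := field (β • s) 1) ?_ ?_ ?_⟩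
    · funext i
      fin_cases i
      · rfl
      · rfl
      · exact h.symm
    · simp only [Equiv.Perm.coe_one, id_eq]; rw [g0, g1]; ring
    · simp only [Equiv.Perm.coe_one, id_eq]; rw [g1, h']; ring
  · have h' : s 0 = s 2 := by
      rw [g2, g0] at h
      have : β * s 0 = β * s 2 := by linarith
      exact mul_left_cancel₀ hβ0.ne' this
    refine ⟨Equiv.swap 1 2, ?_⟩
    have e0 : (Equiv.swap 1 2 : Equiv.Perm (Fin 3)) 0 = 0 := by decide
    have e1 : (Equiv.swap 1 2 : Equiv.Perm (Fin 3)) 1 = 2 := by decide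
    have e2 : (Equiv.swap 1 2 : Equiv.Perm (Fin 3)) 2 = 1 := by decide
    rw [e0, e1, e2]
    refine ⟨h', key (Equiv.swap 0 1) (x := field (β • s) 1) (y := field (β • s) 0) ?_ ?_ ?_⟩
    · funext i
      fin_cases i
      · rfl
      · rfl
      · exact h
    · rw [g0, g1]; ring
    · rw [g0, h']; ring

/-! ### The orbit of maximizers -/

/-- The representative of the orbit of a vector with two equal and one opposite coordinate. -/
structure IsCanonical (s : V3) : Prop where
  eq : s 0 = s 1
  pos : 0 < s 0
  neg : s 2 < 0

theorem TwoEqualOneOpposite.exists_act {s : V3} (h : TwoEqualOneOpposite s) :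
    ∃ σ e, IsCanonical (act σ e s) := by
  obtain ⟨σ, h01, h02⟩ := h
  rcases lt_or_ge 0 (s (σ 0)) with h0 | h0
  · refine ⟨σ, 1, ?_, ?_, ?_⟩ <;> simp only [act_apply, Units.val_one, Int.cast_one, one_mul]
    · exact h01
    · exact h0
    · by_contra! hc
      nlinarith
  · refine ⟨σ, -1, ?_, ?_, ?_⟩ <;>
      simp only [act_apply, Units.val_neg, Units.val_one, Int.cast_neg, Int.cast_one, neg_mul,
        one_mul]
    · rw [h01]
    · rcases h0.lt_or_eq with h | h
      · linarith
      · rw [h, zero_mul] at h02; exact absurd h02 (lt_irrefl _)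
    · by_contra! hc
      nlinarith

theorem IsCanonical.symmCritical {β : ℝ} (hβ : 0 < β) {s : V3} (h : IsCanonical s)
    (hs : meanFieldMap β s = s) :
    SymmCritical (1 / (4 * β)) (β * (2 * s 0 - s 2)) (β * -s 2) := by
  have hc := isCritField_of_fixed hβ hs
  have g0 : field (β • s) 0 = β * (2 * s 0 - s 2) := by
    have : field (β • s) 0 = β * s 0 + β * s 1 - β * s 2 := rfl
    rw [this, ← h.eq]; ring
  have g1 : field (β • s) 1 = -(β * -s 2) := by
    have : field (β • s) 1 = β * s 0 - β * s 1 + β * s 2 := rfl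
    rw [this, ← h.eq]; ring
  have g2 : field (β • s) 2 = -(β * -s 2) := by
    have : field (β • s) 2 = -(β * s 0) + β * s 1 + β * s 2 := rfl
    rw [this, ← h.eq]; ring
  have h0 := hc 0
  have h1 := hc 1
  simp only [coshSum, Fin.sum_univ_three, g0, g1, g2, cosh_neg, sinh_neg] at h0 h1
  have hp := h.pos
  have hn := h.neg
  refine ⟨mul_pos hβ (by linarith), mul_pos hβ (by linarith), ?_, ?_⟩
  · rw [h0]; ring
  · rw [← neg_neg (sinh _), h1]; ring

theorem IsCanonical.eq_of_fixed {β : ℝ} (hβ : 0 < β) {s t : V3} (h : IsCanonical s)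
    (h' : IsCanonical t) (hs : meanFieldMap β s = s) (ht : meanFieldMap β t = t) : s = t := by
  have hu := (h.symmCritical hβ hs).unique (by positivity) (h'.symmCritical hβ ht)
  have h2 : s 2 = t 2 := by
    have := mul_left_cancel₀ hβ.ne' hu.2
    linarith
  have h0 : s 0 = t 0 := by
    have := mul_left_cancel₀ hβ.ne' hu.1
    linarith
  ext i
  fin_cases i
  · exact h0
  · exact h.eq.symm.trans (h0.trans h'.eq)
  · exact h2

theorem exists_isCanonical {β : ℝ} (hβ : 3 / 4 < β) :
    ∃ s ∈ globalMaximizers β, IsCanonical s := by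
  have hβ0 : 0 < β := by linarith
  obtain ⟨s, hs⟩ := exists_forall_Psi_le hβ0
  have hs := (mem_globalMaximizers_iff hβ0).2 hs
  obtain ⟨σ, e, h⟩ := (twoEqualOneOpposite_of_mem hβ hs).exists_act
  exact ⟨_, act_mem_globalMaximizers hβ0 σ e hs, h⟩

theorem fixed_of_mem {β : ℝ} (hβ : 0 < β) {s : V3} (hs : s ∈ globalMaximizers β) :
    meanFieldMap β s = s :=
  meanFieldMap_eq_self hβ ((mem_globalMaximizers_iff hβ).1 hs)

theorem sameOrbit_of_fixed {β : ℝ} (hβ : 0 < β) {s t : V3} (hs : meanFieldMap β s = s)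
    (hs' : TwoEqualOneOpposite s) (ht : meanFieldMap β t = t) (ht' : TwoEqualOneOpposite t) :
    SameOrbit s t := by
  obtain ⟨σ, e, h⟩ := hs'.exists_act
  obtain ⟨τ, d, h'⟩ := ht'.exists_act
  have key := h.eq_of_fixed hβ h' (by rw [meanFieldMap_act, hs]) (by rw [meanFieldMap_act, ht])
  rw [sameOrbit_iff]
  refine ⟨σ * τ.symm, d * e, ?_⟩
  rw [← act_act, key, act_symm_act]

/-- A fixed point of this shape is not assumed to maximize anything; uniqueness places it in the
orbit of an actual maximizer. -/
theorem mem_globalMaximizers_iff_fixed {β : ℝ} (hβ : 3 / 4 < β) {s : V3} :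
    s ∈ globalMaximizers β ↔ MeanFieldEquations β s ∧ TwoEqualOneOpposite s := by
  have hβ0 : 0 < β := by linarith
  rw [meanFieldEquations_iff]
  refine ⟨fun h => ⟨fixed_of_mem hβ0 h, twoEqualOneOpposite_of_mem hβ h⟩, fun ⟨h, h'⟩ => ?_⟩
  obtain ⟨t, ht, -⟩ := exists_isCanonical hβ
  obtain ⟨σ, e, rfl⟩ := sameOrbit_iff.1
    (sameOrbit_of_fixed hβ0 (fixed_of_mem hβ0 ht) (twoEqualOneOpposite_of_mem hβ ht) h h')
  exact act_mem_globalMaximizers hβ0 σ e ht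

theorem mem_globalMaximizers_iff_sameOrbit {β : ℝ} (hβ : 3 / 4 < β) {s : V3}
    (hs : s ∈ globalMaximizers β) (t : V3) : t ∈ globalMaximizers β ↔ SameOrbit s t := by
  have hβ0 : 0 < β := by linarith
  constructor
  · intro ht
    exact sameOrbit_of_fixed hβ0 (fixed_of_mem hβ0 hs) (twoEqualOneOpposite_of_mem hβ hs)
      (fixed_of_mem hβ0 ht) (twoEqualOneOpposite_of_mem hβ ht)
  · rintro h
    obtain ⟨σ, e, rfl⟩ := sameOrbit_iff.1 h
    exact act_mem_globalMaximizers hβ0 σ e hs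

/-- A point of the orbit is determined by the position of its odd coordinate and the global sign:
three times two choices. -/
theorem IsCanonical.ncard_orbit {s : V3} (h : IsCanonical s) :
    {t | SameOrbit s t}.ncard = 6 := by
  have hp := h.pos
  have hn := h.neg
  let f : Fin 3 × ℤˣ → V3 := fun q => act (Equiv.swap q.1 2) q.2 s
  have hf : ∀ q i, f q i = ((q.2 : ℤ) : ℝ) * (if i = q.1 then s 2 else s 0) := by
    rintro ⟨k, e⟩ i
    have : ∀ k i : Fin 3, (Equiv.swap k 2 i = 2 ↔ i = k) := by decide
    simp only [f, act_apply]
    congr 1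
    split_ifs with hik
    · rw [(this k i).2 hik]
    · have h2 : ∀ j : Fin 3, j ≠ 2 → s j = s 0 := by
        intro j hj
        fin_cases j
        · rfl
        · exact h.eq.symm
        · exact absurd rfl hj
      exact h2 _ (mt (this k i).1 hik)
  have hinj : Function.Injective f := by
    rintro ⟨k, e⟩ ⟨k', e'⟩ hq
    have hq' : ∀ i, ((e : ℤ) : ℝ) * (if i = k then s 2 else s 0)
        = ((e' : ℤ) : ℝ) * (if i = k' then s 2 else s 0) := by
      intro i
      rw [← hf (k, e) i, ← hf (k', e') i, hq]
    have hother : ∀ k k' : Fin 3, ∃ j, j ≠ k ∧ j ≠ k' := by decide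
    obtain ⟨j, hj, hj'⟩ := hother k k'
    have h1 := hq' j
    rw [if_neg hj, if_neg hj'] at h1
    have h2 := mul_right_cancel₀ hp.ne' h1
    have h3 : e = e' := Units.ext (Int.cast_injective h2)
    subst h3
    by_contra hne
    have hk : k ≠ k' := fun hk => hne (by rw [hk])
    have h4 := hq' k
    have h5 : ((e : ℤ) : ℝ) ≠ 0 := by
      intro h0
      have := units_mul_self_real e
      rw [h0] at this
      norm_num at this
    rw [if_pos rfl, if_neg hk] at h4
    have := mul_left_cancel₀ h5 h4
    linarith
  have hrange : {t | SameOrbit s t} = Set.range f := by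
    ext t
    rw [Set.mem_ofPred_eq, sameOrbit_iff]
    constructor
    · rintro ⟨σ, e, rfl⟩
      refine ⟨(σ.symm 2, e), ?_⟩
      ext i
      rw [hf, act_apply]
      congr 1
      have h2 : ∀ j : Fin 3, j ≠ 2 → s j = s 0 := by
        intro j hj
        fin_cases j
        · rfl
        · exact h.eq.symm
        · exact absurd rfl hj
      split_ifs with hik
      · rw [hik, Equiv.apply_symm_apply]
      · exact (h2 _ fun hc => hik (by rw [← hc, Equiv.symm_apply_apply])).symm
    · rintro ⟨⟨k, e⟩, rfl⟩
      exact ⟨_, _, rfl⟩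
  rw [hrange, ← Set.image_univ, Set.ncard_image_of_injective _ hinj, Set.ncard_univ]
  simp

theorem ncard_globalMaximizers {β : ℝ} (hβ : 3 / 4 < β) : (globalMaximizers β).ncard = 6 := by
  obtain ⟨s, hs, hc⟩ := exists_isCanonical hβ
  rw [← hc.ncard_orbit]
  congr 1
  ext t
  exact mem_globalMaximizers_iff_sameOrbit hβ hs t

/-! ### The mean-field measure -/

theorem integral_meanField (β : ℝ) (n : ℕ) (h : (Fin n → NAE3) → ℝ) :
    ∫ x, h x ∂(meanField β n) = ∑ x, weight β n x / partitionFunction β n * h x := by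
  rw [meanField, PMF.integral_eq_sum]
  refine Finset.sum_congr rfl fun x _ => ?_
  rw [meanFieldPMF, PMF.ofFintype_apply, ENNReal.toReal_ofReal, smul_eq_mul]
  exact (div_pos (weight_pos β n x) (partitionFunction_pos β n)).le

theorem meanField_real (β : ℝ) (n : ℕ) (A : Set (Fin n → NAE3)) :
    (meanField β n).real A
      = (∑ x, A.indicator (fun x => weight β n x) x) / partitionFunction β n := by
  have hA : MeasurableSet A := A.toFinite.measurableSet
  rw [← integral_indicator_one hA, integral_meanField, Finset.sum_div]
  refine Finset.sum_congr rfl fun x _ => ?_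
  by_cases hx : x ∈ A <;> simp [hx]

theorem smul_meanVote (n : ℕ) (x : Fin n → NAE3) :
    (n : ℝ) • meanVote n x = ∑ i, (x i).vec := by
  rcases Nat.eq_zero_or_pos n with rfl | hn
  · simp
  · rw [meanVote, smul_inv_smul₀ (by positivity)]

theorem weight_eq (β : ℝ) (n : ℕ) (x : Fin n → NAE3) :
    weight β n x = exp (n * (β / 2 * ‖meanVote n x‖ ^ 2)) := by
  have h : ∑ i, ∑ j, inner ℝ (x i).vec (x j).vec = (n * ‖meanVote n x‖) ^ 2 := by
    have e : ∑ i, ∑ j, inner ℝ (x i).vec (x j).vec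
        = inner ℝ (∑ i, (x i).vec) (∑ i, (x i).vec) := by
      simp only [sum_inner, inner_sum]
      exact Finset.sum_comm
    rw [e, ← smul_meanVote, real_inner_self_eq_norm_sq, norm_smul, Real.norm_natCast]
  rw [weight, h]
  congr 1
  rcases Nat.eq_zero_or_pos n with rfl | hn
  · simp
  · field_simp

theorem sum_exp_inner_meanVote (n : ℕ) (l : V3) :
    ∑ x : Fin n → NAE3, exp (n * inner ℝ l (meanVote n x)) = mgfSum l ^ n := by
  rw [mgfSum, Fintype.sum_pow]
  refine Finset.sum_congr rfl fun x _ => ?_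
  rw [← real_inner_smul_right, smul_meanVote, inner_sum, exp_sum]

/-- With the energy linearized at `t`, the sum over profiles factorizes over voters. -/
theorem exp_mul_Psi (β : ℝ) (n : ℕ) (t : V3) :
    exp (n * Psi β t)
      = ∑ x : Fin n → NAE3, exp (n * (β * inner ℝ t (meanVote n x) - β / 2 * ‖t‖ ^ 2)) := by
  have h : ∀ x : Fin n → NAE3, exp (n * (β * inner ℝ t (meanVote n x) - β / 2 * ‖t‖ ^ 2))
      = exp (n * inner ℝ (β • t) (meanVote n x)) * exp (-(n * (β / 2 * ‖t‖ ^ 2))) := by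
    intro x
    rw [← exp_add, inner_smul_left, conj_trivial]
    ring_nf
  simp only [h]
  rw [← Finset.sum_mul, sum_exp_inner_meanVote, Psi, mul_sub, sub_eq_add_neg, exp_add,
    exp_nat_mul, exp_log (mgfSum_pos _)]

/-- The linearization at `t` is a lower bound when `β ≥ 0`, with error at most `β δ² / 2` on the
ball of radius `δ`; these facts give the two exponential bounds that follow. -/
theorem half_norm_sq_eq (β : ℝ) (s t : V3) :
    β / 2 * ‖s‖ ^ 2 = (β * inner ℝ t s - β / 2 * ‖t‖ ^ 2) + β / 2 * ‖s - t‖ ^ 2 := by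
  rw [norm_sub_sq_real, real_inner_comm]; ring

theorem exp_mul_Psi_le_partitionFunction {β : ℝ} (hβ : 0 ≤ β) (n : ℕ) (t : V3) :
    exp (n * Psi β t) ≤ partitionFunction β n := by
  rw [exp_mul_Psi, partitionFunction]
  refine Finset.sum_le_sum fun x _ => ?_
  rw [weight_eq, exp_le_exp]
  refine mul_le_mul_of_nonneg_left ?_ (Nat.cast_nonneg n)
  rw [half_norm_sq_eq β (meanVote n x) t]
  have : 0 ≤ β / 2 * ‖meanVote n x - t‖ ^ 2 := by positivity
  linarith

theorem meanField_real_ball_le {β : ℝ} (hβ : 0 ≤ β) (n : ℕ) (s t : V3) {δ : ℝ} :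
    (meanField β n).real {x | meanVote n x ∈ Metric.ball t δ}
      ≤ exp (n * (Psi β t + β / 2 * δ ^ 2 - Psi β s)) := by
  have hsum : ∑ x, {x | meanVote n x ∈ Metric.ball t δ}.indicator (fun x => weight β n x) x
      ≤ exp (n * (Psi β t + β / 2 * δ ^ 2)) := by
    have e : exp (n * (Psi β t + β / 2 * δ ^ 2))
        = exp (n * Psi β t) * exp (n * (β / 2 * δ ^ 2)) := by rw [← exp_add]; ring_nf
    rw [e, exp_mul_Psi, Finset.sum_mul]
    refine Finset.sum_le_sum fun x _ => ?_
    by_cases hx : meanVote n x ∈ Metric.ball t δ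
    · rw [indicator_of_mem (by exact hx), weight_eq, ← exp_add, exp_le_exp, half_norm_sq_eq β _ t,
        ← mul_add]
      rw [mem_ball_iff_norm] at hx
      have : ‖meanVote n x - t‖ ^ 2 ≤ δ ^ 2 := pow_le_pow_left₀ (norm_nonneg _) hx.le 2
      gcongr
    · rw [indicator_of_notMem (by exact hx)]
      positivity
  rw [meanField_real, div_le_iff₀ (partitionFunction_pos β n)]
  calc _ ≤ exp (n * (Psi β t + β / 2 * δ ^ 2)) := hsum
    _ = exp (n * (Psi β t + β / 2 * δ ^ 2 - Psi β s)) * exp (n * Psi β s) := by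
        rw [← exp_add]; ring_nf
    _ ≤ _ := mul_le_mul_of_nonneg_left (exp_mul_Psi_le_partitionFunction hβ n s) (exp_pos _).le

theorem norm_meanVote_le (n : ℕ) (x : Fin n → NAE3) : ‖meanVote n x‖ ≤ 2 := by
  rcases Nat.eq_zero_or_pos n with rfl | hn
  · simp [meanVote]
  · have hn' : (0 : ℝ) < n := by exact_mod_cast hn
    have h : ‖∑ i, (x i).vec‖ ≤ ∑ _i : Fin n, (2 : ℝ) :=
      (norm_sum_le _ _).trans (Finset.sum_le_sum fun i _ => norm_vec_le (x i))
    simp only [Finset.sum_const, Finset.card_univ, Fintype.card_fin, nsmul_eq_mul] at h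
    rw [meanVote, norm_smul, norm_inv, Real.norm_natCast, inv_mul_le_iff₀ hn']
    exact h

/-! ### Large deviations -/

theorem exists_two_mul_exp_bound {C η : ℝ} (hC : 2 ≤ C) (hη : 0 < η) :
    ∃ c : ℝ, 0 < c ∧ ∀ (n : ℕ) (q : ℝ), q ≤ 1 → q ≤ C * exp (-η * n) → q ≤ 2 * exp (-c * n) := by
  have h2 : 0 < log 2 := log_pos one_lt_two
  have hlog : log 2 ≤ log C := log_le_log two_pos hC
  have hC0 : 0 < log C := h2.trans_le hlog
  -- With `θ = log 2 / log C ≤ 1`, `min 1 z ≤ z ^ θ` for `z = C exp (-ηn)`, and `C ^ θ = 2`.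
  refine ⟨log 2 / log C * η, by positivity, fun n q hq1 hq => ?_⟩
  have hC' : C * exp (-η * n) = exp (log C - η * n) := by
    rw [sub_eq_add_neg, exp_add, exp_log (by linarith), neg_mul]
  have h2' : 2 * exp (-(log 2 / log C * η) * n) = exp (log 2 / log C * (log C - η * n)) := by
    rw [mul_sub, div_mul_cancel₀ _ hC0.ne', sub_eq_add_neg, exp_add, exp_log two_pos]
    ring_nf
  have hθ : log 2 / log C ≤ 1 := (div_le_one hC0).2 hlog
  have hθ0 : 0 ≤ log 2 / log C := by positivity
  rw [h2']
  rcases le_or_gt (log C - η * n) 0 with h | h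
  · refine hq.trans ?_
    rw [hC', exp_le_exp]
    nlinarith
  · exact hq1.trans (one_le_exp (by positivity))

theorem large_deviation {β : ℝ} (hβ : 0 < β) {ε : ℝ} (hε : 0 < ε) :
    ∃ c : ℝ, 0 < c ∧ ∀ n : ℕ, (meanField β n).real
      {x | ∀ s ∈ globalMaximizers β, ε ≤ ‖meanVote n x - s‖} ≤ 2 * exp (-c * n) := by
  obtain ⟨s₀, hs₀⟩ := exists_forall_Psi_le hβ
  let K : Set V3 := Metric.closedBall 0 2 ∩ {t | ∀ s ∈ globalMaximizers β, ε ≤ ‖t - s‖}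
  have hKclosed : IsClosed {t : V3 | ∀ s ∈ globalMaximizers β, ε ≤ ‖t - s‖} := by
    simp only [Set.ofPred_forall]
    exact isClosed_iInter fun s => isClosed_iInter fun _ =>
      isClosed_le continuous_const (by fun_prop)
  have hK : IsCompact K := (isCompact_closedBall 0 2).inter_right hKclosed
  have hlt : ∀ t ∈ K, Psi β t < Psi β s₀ := by
    intro t ht
    by_contra! hc
    have := ht.2 t ((mem_globalMaximizers_iff hβ).2 fun r => (hs₀ r).trans hc)
    rw [sub_self, norm_zero] at this
    linarith
  -- The gap is `2η` because the covering balls consume one `η` through `β / 2 * δ ^ 2`.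
  obtain ⟨η, hη, hKη⟩ : ∃ η : ℝ, 0 < η ∧ ∀ t ∈ K, Psi β t ≤ Psi β s₀ - 2 * η := by
    rcases K.eq_empty_or_nonempty with h | h
    · exact ⟨1, one_pos, by simp [h]⟩
    · obtain ⟨r, hr, hmax⟩ := hK.exists_isMaxOn h (continuous_Psi β).continuousOn
      refine ⟨(Psi β s₀ - Psi β r) / 2, by linarith [hlt r hr], fun t ht => ?_⟩
      have : Psi β t ≤ Psi β r := hmax ht
      linarith
  obtain ⟨δ, hδ, hδη⟩ : ∃ δ : ℝ, 0 < δ ∧ β / 2 * δ ^ 2 = η := by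
    refine ⟨√(2 * η / β), by positivity, ?_⟩
    rw [Real.sq_sqrt (by positivity)]
    field_simp
  obtain ⟨T, hTK, hTfin, hcover⟩ := hK.finite_cover_balls hδ
  obtain ⟨c, hc, hbound⟩ := exists_two_mul_exp_bound
    -- The summand 2 secures `2 ≤ C` even when the cover is empty.
    (C := hTfin.toFinset.card + 2) (η := η)
    (by linarith [Nat.cast_nonneg (α := ℝ) hTfin.toFinset.card]) hη
  refine ⟨c, hc, fun n => hbound n _ measureReal_le_one ?_⟩
  have hsub : {x | ∀ s ∈ globalMaximizers β, ε ≤ ‖meanVote n x - s‖}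
      ⊆ ⋃ t ∈ hTfin.toFinset, {x | meanVote n x ∈ Metric.ball t δ} := by
    intro x hx
    have : meanVote n x ∈ K := ⟨by simpa using norm_meanVote_le n x, hx⟩
    simpa using hcover this
  calc _ ≤ (meanField β n).real (⋃ t ∈ hTfin.toFinset, {x | meanVote n x ∈ Metric.ball t δ}) :=
        measureReal_mono hsub (measure_ne_top _ _)
    _ ≤ ∑ t ∈ hTfin.toFinset, (meanField β n).real {x | meanVote n x ∈ Metric.ball t δ} :=
        measureReal_biUnion_finset_le _ _
    _ ≤ ∑ t ∈ hTfin.toFinset, exp (-η * n) := by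
        refine Finset.sum_le_sum fun t ht => ?_
        refine (meanField_real_ball_le hβ.le n s₀ t).trans (exp_le_exp.2 ?_)
        have h1 := hKη t (hTK (hTfin.mem_toFinset.1 ht))
        rw [hδη, mul_comm]
        exact mul_le_mul_of_nonneg_right (by linarith) (Nat.cast_nonneg n)
    _ ≤ _ := by
        rw [Finset.sum_const, nsmul_eq_mul]
        exact mul_le_mul_of_nonneg_right (by linarith) (exp_pos _).le

/-! ### Convergence in distribution -/

theorem meanVote_actVote (n : ℕ) (σ : Equiv.Perm (Fin 3)) (e : ℤˣ) (x : Fin n → NAE3) :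
    meanVote n (fun i => actVote σ e (x i)) = act σ e (meanVote n x) := by
  simp only [meanVote, vec_actVote, map_smul, map_sum]

theorem integral_act_meanVote (β : ℝ) (n : ℕ) (f : V3 → ℝ) (σ : Equiv.Perm (Fin 3)) (e : ℤˣ) :
    ∫ x, f (act σ e (meanVote n x)) ∂(meanField β n) = ∫ x, f (meanVote n x) ∂(meanField β n) := by
  symm
  rw [integral_meanField, integral_meanField,
    ← Equiv.sum_comp (Equiv.piCongrRight fun _ : Fin n => actVote σ e)]
  refine Finset.sum_congr rfl fun x _ => ?_
  have h : (Equiv.piCongrRight fun _ : Fin n => actVote σ e) x = fun i => actVote σ e (x i) := rfl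
  rw [h, weight_eq, weight_eq, meanVote_actVote, LinearIsometry.norm_map]

theorem integral_uniformOn (S : Finset V3) (f : V3 → ℝ) :
    ∫ s, f s ∂(uniformOn (S : Set V3)) = (S.card : ℝ)⁻¹ * ∑ s ∈ S, f s := by
  have hfin : IntegrableOn f (S : Set V3) Measure.count := by
    rw [← Set.biUnion_of_singleton (S : Set V3)]
    exact (integrableOn_finite_biUnion S.finite_toSet).2 fun s _ => by
      simp [integrableOn_singleton_iff]
  rw [uniformOn, ProbabilityTheory.cond, integral_smul_measure, setIntegral_finset S hfin]
  simp [Measure.count_apply_finset, measureReal_def]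

/-- The sum of a function over the symmetries. -/
noncomputable def symmSum (f : V3 → ℝ) (s : V3) : ℝ :=
  ∑ g : Equiv.Perm (Fin 3) × ℤˣ, f (act g.1 g.2 s)

theorem symmSum_act (f : V3 → ℝ) (σ : Equiv.Perm (Fin 3)) (e : ℤˣ) (s : V3) :
    symmSum f (act σ e s) = symmSum f s := by
  unfold symmSum
  symm
  rw [← Equiv.sum_comp ((Equiv.mulLeft σ).prodCongr (Equiv.mulRight e))]
  refine Finset.sum_congr rfl fun g _ => ?_
  rw [act_act]
  rfl

/-- Concentration near the maximizers alone determines the limit here, since no information on how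
mass is shared among them is needed. -/
theorem tendsto_integral_of_const_on_maximizers {β : ℝ} (hβ : 0 < β) {F : V3 → ℝ}
    (hF : Continuous F) {M : ℝ} (hM : ∀ s, |F s| ≤ M) {c : ℝ}
    (hfin : (globalMaximizers β).Finite) (hc : ∀ s ∈ globalMaximizers β, F s = c) :
    Tendsto (fun n => ∫ x, F (meanVote n x) ∂(meanField β n)) atTop (𝓝 c) := by
  rw [Metric.tendsto_atTop]
  intro ε hε
  obtain ⟨r, hr, hclose⟩ : ∃ r : ℝ, 0 < r ∧
      ∀ s ∈ globalMaximizers β, ∀ t, ‖t - s‖ < r → |F t - c| < ε / 2 := by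
    have hev : ∀ s ∈ globalMaximizers β, ∀ᶠ r : ℝ in 𝓝[>] 0,
        ∀ t, ‖t - s‖ < r → |F t - c| < ε / 2 := by
      intro s hs
      obtain ⟨r, hr, h⟩ := Metric.continuousAt_iff.1 hF.continuousAt (ε / 2) (half_pos hε)
      filter_upwards [Ioo_mem_nhdsGT hr] with r' hr' t ht
      have := h (x := t) (by rw [dist_eq_norm]; exact ht.trans hr'.2)
      rwa [Real.dist_eq, hc s hs] at this
    obtain ⟨r, h1, h2⟩ := (((hfin.eventually_all).2 hev).and self_mem_nhdsWithin).exists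
    exact ⟨r, h2, h1⟩
  obtain ⟨d, hd, hld⟩ := large_deviation hβ hr
  have hbound : ∀ n, |∫ x, F (meanVote n x) ∂(meanField β n) - c|
      ≤ ε / 2 + (M + |c|) * (2 * exp (-d * n)) := by
    intro n
    let A : Set (Fin n → NAE3) := {x | ∀ s ∈ globalMaximizers β, r ≤ ‖meanVote n x - s‖}
    have hA : MeasurableSet A := A.toFinite.measurableSet
    have hMc : 0 ≤ M + |c| := by
      have := (abs_nonneg _).trans (hM 0)
      positivity
    have h1 : ∫ x, F (meanVote n x) ∂(meanField β n) - c
        = ∫ x, (F (meanVote n x) - c) ∂(meanField β n) := by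
      rw [integral_sub .of_finite .of_finite]
      simp
    rw [h1]
    calc _ ≤ ∫ x, |F (meanVote n x) - c| ∂(meanField β n) := abs_integral_le_integral_abs
      _ ≤ ∫ x, (ε / 2 + A.indicator (fun _ => M + |c|) x) ∂(meanField β n) := by
          refine integral_mono .of_finite .of_finite fun x => ?_
          by_cases hx : x ∈ A
          · simp only [indicator_of_mem hx]
            have := abs_sub (F (meanVote n x)) c
            linarith [hM (meanVote n x)]
          · simp only [indicator_of_notMem hx, add_zero]
            simp only [A, Set.mem_ofPred_eq, not_forall, not_le] at hx
            obtain ⟨s, hs, hxs⟩ := hx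
            exact (hclose s hs _ hxs).le
      _ = ε / 2 + (M + |c|) * (meanField β n).real A := by
          rw [integral_add .of_finite .of_finite, integral_indicator_const _ hA]
          simp [mul_comm]
      _ ≤ _ := by
          gcongr
          exact hld n
  have hlim : Tendsto (fun n : ℕ => (M + |c|) * (2 * exp (-d * n))) atTop (𝓝 0) := by
    have h1 : Tendsto (fun n : ℕ => -d * (n : ℝ)) atTop atBot :=
      tendsto_natCast_atTop_atTop.const_mul_atTop_of_neg (by linarith)
    have := ((tendsto_exp_atBot.comp h1).const_mul 2).const_mul (M + |c|)
    simpa using this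
  obtain ⟨N, hN⟩ := (hlim.eventually (gt_mem_nhds (half_pos hε))).exists_forall_of_atTop
  refine ⟨N, fun n hn => ?_⟩
  rw [Real.dist_eq]
  linarith [hbound n, hN n hn]

theorem tendstoInDistribution_meanVote {β : ℝ} (hβ : 3 / 4 < β)
    [IsProbabilityMeasure (uniformOn (globalMaximizers β))] :
    TendstoInDistribution (fun n : ℕ => meanVote n) atTop (id : V3 → V3)
      (fun n => meanField β n) (uniformOn (globalMaximizers β)) := by
  have hβ0 : 0 < β := by linarith
  have hfin : (globalMaximizers β).Finite :=
    Set.finite_of_ncard_ne_zero (by rw [ncard_globalMaximizers hβ]; norm_num)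
  have hmeas : ∀ n, Measurable (meanVote n) := fun n => measurable_of_finite _
  refine ⟨fun n => (hmeas n).aemeasurable, aemeasurable_id, ?_⟩
  refine ProbabilityMeasure.tendsto_iff_forall_integral_tendsto.2 fun f => ?_
  simp only [ProbabilityMeasure.coe_mk, Measure.map_id]
  have hmap : ∀ n, ∫ s, f s ∂((meanField β n).map (meanVote n))
      = ∫ x, f (meanVote n x) ∂(meanField β n) := fun n =>
    integral_map (hmeas n).aemeasurable f.continuous.aestronglyMeasurable
  simp only [hmap]
  obtain ⟨s₀, hs₀, -⟩ := exists_isCanonical hβ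
  -- The law of `meanVote` and the uniform measure are both invariant under the symmetries, so `f`
  -- may be replaced by `symmSum f`, which is constant on the single orbit.
  have hconst : ∀ s ∈ globalMaximizers β, symmSum f s = symmSum f s₀ := by
    intro s hs
    obtain ⟨σ, e, rfl⟩ :=
      sameOrbit_iff.1 ((mem_globalMaximizers_iff_sameOrbit hβ hs₀ s).1 hs)
    exact symmSum_act f σ e s₀
  have hcont : Continuous (symmSum f) :=
    continuous_finsetSum _ fun g _ => f.continuous.comp (act g.1 g.2).continuous
  have hcard : (Fintype.card (Equiv.Perm (Fin 3) × ℤˣ) : ℝ) ≠ 0 := by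
    exact_mod_cast Fintype.card_ne_zero
  have hbdd : ∀ s, |symmSum f s| ≤ ∑ _g : Equiv.Perm (Fin 3) × ℤˣ, ‖f‖ := fun s =>
    (Finset.abs_sum_le_sum_abs _ _).trans (Finset.sum_le_sum fun g _ => f.norm_coe_le_norm _)
  have hlim := tendsto_integral_of_const_on_maximizers hβ0 hcont hbdd hfin hconst
  have hleft : ∀ n, ∫ x, symmSum f (meanVote n x) ∂(meanField β n)
      = Fintype.card (Equiv.Perm (Fin 3) × ℤˣ) * ∫ x, f (meanVote n x) ∂(meanField β n) := by
    intro n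
    unfold symmSum
    rw [integral_finsetSum _ fun g _ => .of_finite]
    simp only [integral_act_meanVote β n f]
    simp
  have hright : symmSum f s₀ = Fintype.card (Equiv.Perm (Fin 3) × ℤˣ)
      * ∫ s, f s ∂(uniformOn (globalMaximizers β)) := by
    obtain ⟨S, hS⟩ := hfin.exists_finset_coe
    have hSmem : ∀ s, s ∈ S ↔ s ∈ globalMaximizers β := fun s => by
      rw [← hS, Finset.mem_coe]
    have hScard : (S.card : ℝ) ≠ 0 := by
      exact_mod_cast (Finset.card_pos.2 ⟨s₀, (hSmem s₀).2 hs₀⟩).ne'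
    have hinv : ∀ g : Equiv.Perm (Fin 3) × ℤˣ, ∑ s ∈ S, f (act g.1 g.2 s) = ∑ s ∈ S, f s := by
      intro g
      refine Finset.sum_nbij' (fun s => act g.1 g.2 s) (fun s => act g.1.symm g.2 s) ?_ ?_ ?_ ?_ ?_
      · exact fun s hs => (hSmem _).2 (act_mem_globalMaximizers hβ0 _ _ ((hSmem s).1 hs))
      · exact fun s hs => (hSmem _).2 (act_mem_globalMaximizers hβ0 _ _ ((hSmem s).1 hs))
      · exact fun s _ => act_symm_act _ _ s
      · exact fun s _ => act_act_symm _ _ s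
      · exact fun s _ => rfl
    have h1 : ∑ s ∈ S, symmSum f s = S.card * symmSum f s₀ := by
      rw [Finset.sum_congr rfl fun s hs => hconst s ((hSmem s).1 hs), Finset.sum_const,
        nsmul_eq_mul]
    have h2 : ∑ s ∈ S, symmSum f s
        = Fintype.card (Equiv.Perm (Fin 3) × ℤˣ) * ∑ s ∈ S, f s := by
      unfold symmSum
      rw [Finset.sum_comm]
      simp only [hinv]
      simp
    rw [← hS, integral_uniformOn]
    rw [h1] at h2
    field_simp
    linarith
  simp only [hleft, hright] at hlim
  have := hlim.const_mul (Fintype.card (Equiv.Perm (Fin 3) × ℤˣ) : ℝ)⁻¹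
  simpa only [inv_mul_cancel_left₀ hcard] using this

end MeanFieldElection

theorem mainTheorem5 (β : ℝ) (hβ : 3 / 4 < β) :
    -- `Φ` has exactly six global maximizers: they form one orbit under the symmetries, and they
    -- are the solutions of the mean-field equations with two equal coordinates and the third of
    -- opposite sign
    (MeanFieldElection.globalMaximizers β).ncard = 6 ∧
    (∀ s ∈ MeanFieldElection.globalMaximizers β, ∀ t,
      t ∈ MeanFieldElection.globalMaximizers β ↔ MeanFieldElection.SameOrbit s t) ∧
    (∀ s, s ∈ MeanFieldElection.globalMaximizers β ↔
      MeanFieldElection.MeanFieldEquations β s ∧ MeanFieldElection.TwoEqualOneOpposite s) ∧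
    -- convergence in distribution of the mean vote to the uniform measure on the maximizers
    (∃ _ : IsProbabilityMeasure (uniformOn (MeanFieldElection.globalMaximizers β)),
      TendstoInDistribution (fun n : ℕ => MeanFieldElection.meanVote n) atTop
        (id : EuclideanSpace ℝ (Fin 3) → EuclideanSpace ℝ (Fin 3))
        (fun n => MeanFieldElection.meanField β n)
        (uniformOn (MeanFieldElection.globalMaximizers β))) ∧
    -- the large deviation bound
    (∀ ε : ℝ, 0 < ε → ∃ c : ℝ, 0 < c ∧ ∀ n : ℕ, 1 ≤ n →
      (MeanFieldElection.meanField β n).real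
          {x | ∀ s ∈ MeanFieldElection.globalMaximizers β,
            ε ≤ ‖MeanFieldElection.meanVote n x - s‖} ≤
        2 * Real.exp (-c * n)) := by
  have hβ0 : 0 < β := by linarith
  have hcard := MeanFieldElection.ncard_globalMaximizers hβ
  have hprob : IsProbabilityMeasure (uniformOn (MeanFieldElection.globalMaximizers β)) :=
    isProbabilityMeasure_uniformOn
      (Set.finite_of_ncard_ne_zero (by rw [hcard]; norm_num))
      (Set.nonempty_of_ncard_ne_zero (by rw [hcard]; norm_num))
  refine ⟨hcard, fun s hs t => MeanFieldElection.mem_globalMaximizers_iff_sameOrbit hβ hs t,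
    fun s => MeanFieldElection.mem_globalMaximizers_iff_fixed hβ,
    ⟨hprob, MeanFieldElection.tendstoInDistribution_meanVote hβ⟩, fun ε hε => ?_⟩
  obtain ⟨c, hc, h⟩ := MeanFieldElection.large_deviation hβ0 hε
  exact ⟨c, hc, fun n _ => h n⟩
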